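/- Matet forcing $\mathbb T$ consists of the pairs $(s,A)$, where $s$ is a finite strictly increasing sequence of natural numbers (identified with its range) and $A$ is an infinite set of nonempty finite subsets of $\omega$ that is linearly ordered by $a<b\iff\max a<\min b$, and with $\max s<\min a$ for all $a\in A$. Put $(t,B)\le(s,A)$ iff $s\subseteq t$, every $b\in B$ is a finite union of members of $A$, and $t\setminus s$ is a finite (possibly empty) union of members of $A$. Let $[(s,A)]\subseteq 2^\omega$ be the set of all $s\cup\bigcup D$ with $D\subseteq A$ infinite (subsets of $\omega$ are identified with their characteristic functions), let $V$ be the ground model, and let $x_G=\bigcup\{s:(s,A)\in G\}$ be the Matet real of the generic filter $G$. A real is an element of $2^\omega$. Theorem. Matet forcing adds reals of minimal degree. That is: (1) Every condition forces that $x_G$ is a real that is not in $V$. (2) Let $(s,A)\in\mathbb T$ and let $\dot x$ be a $\mathbb T$-name such that $(s,A)$ forces that $\dot x$ is a real not in $V$. Then there are a condition $(s,B)\le(s,A)$ with the same stem and, in $V$, a continuous injective function $f:[(s,B)]\to 2^\omega$ such that $(s,B)\Vdash f(x_G)=\dot x$. Moreover $\dot x$ recovers the generic real: in $V$ there is a continuous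 function $g:f[[(s,B)]]\to 2^\omega$ with $g(f(y))=y$ for all $y\in[(s,B)]$ and $(s,B)\Vdash g(\dot x)=x_G$; in particular $(s,B)\Vdash x_G\in V[\dot x]$. Here the value of a continuous function $h:K\to2^\omega$ of $V$ at a real $x$ of $V[G]$ is the one given by its canonical code: $n\in h(x)$ iff some finite initial segment $\sigma$ of $x$ is such that, in $V$, $n\in h(y)$ for all $y\in K$ extending $\sigma$. -/

import Mathlib

universe u

/-! ## Matet forcing -/

/-- `a < b` for finite sets of natural numbers: every element of `a` is below every element
of `b` (that is, `max a < min b` when both are nonempty). -/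
def BlockLT (a b : Finset ℕ) : Prop := ∀ i ∈ a, ∀ j ∈ b, i < j

/-- `b` is a (possibly empty) finite union of members of `A`. -/
def IsFiniteUnion (A : Set (Finset ℕ)) (b : Finset ℕ) : Prop :=
  ∃ F : Finset (Finset ℕ), (F : Set (Finset ℕ)) ⊆ A ∧ b = F.biUnion id

/-- A Matet condition `(s, A)`. The strictly increasing finite sequence `s` is given by its
range; `A` is an infinite set of nonempty finite sets, linearly ordered by `max a < min b`,
all lying above `s`. -/
@[ext]
structure MatetCond where
  stem : Finset ℕ
  blocks : Set (Finset ℕ)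
  infinite : blocks.Infinite
  nonempty : ∀ a ∈ blocks, a.Nonempty
  ordered : ∀ a ∈ blocks, ∀ b ∈ blocks, a ≠ b → BlockLT a b ∨ BlockLT b a
  stem_lt : ∀ a ∈ blocks, BlockLT stem a

theorem IsFiniteUnion.empty (A : Set (Finset ℕ)) : IsFiniteUnion A ∅ :=
  ⟨∅, by simp, by simp⟩

theorem IsFiniteUnion.of_mem {A : Set (Finset ℕ)} {a : Finset ℕ} (h : a ∈ A) :
    IsFiniteUnion A a :=
  ⟨{a}, by simpa using h, by simp⟩

theorem IsFiniteUnion.union {A : Set (Finset ℕ)} {a b : Finset ℕ}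
    (ha : IsFiniteUnion A a) (hb : IsFiniteUnion A b) : IsFiniteUnion A (a ∪ b) := by
  obtain ⟨F, hF, rfl⟩ := ha
  obtain ⟨H, hH, rfl⟩ := hb
  refine ⟨F ∪ H, ?_, ?_⟩
  · rw [Finset.coe_union]
    exact Set.union_subset hF hH
  · rw [Finset.union_biUnion]

theorem IsFiniteUnion.trans {A B : Set (Finset ℕ)} (h : ∀ b ∈ B, IsFiniteUnion A b)
    {c : Finset ℕ} (hc : IsFiniteUnion B c) : IsFiniteUnion A c := by
  obtain ⟨F, hF, rfl⟩ := hc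
  induction F using Finset.induction_on with
  | empty => simpa using IsFiniteUnion.empty A
  | insert a F _ ih =>
    rw [Finset.biUnion_insert]
    rw [Finset.coe_insert, Set.insert_subset_iff] at hF
    exact (h _ hF.1).union (ih hF.2)

/-- `(t, B) ≤ (s, A)`: `t` extends `s`, every member of `B` is a finite union of members of `A`,
and so is `t \ s`. (Then `t` is automatically an end-extension of `s`.) -/
instance : Preorder MatetCond where
  le q p := p.stem ⊆ q.stem ∧ (∀ b ∈ q.blocks, IsFiniteUnion p.blocks b) ∧
    IsFiniteUnion p.blocks (q.stem \ p.stem)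
  le_refl p := ⟨subset_rfl, fun _ h => .of_mem h, by simpa using IsFiniteUnion.empty _⟩
  le_trans r q p h₁ h₂ := by
    refine ⟨h₂.1.trans h₁.1, fun b hb => .trans h₂.2.1 (h₁.2.1 b hb), ?_⟩
    have h : r.stem \ p.stem = (r.stem \ q.stem) ∪ (q.stem \ p.stem) := by
      ext n
      have a := @h₁.1 n
      have b := @h₂.1 n
      simp only [Finset.mem_sdiff, Finset.mem_union]
      tauto
    rw [h]
    exact (IsFiniteUnion.trans h₂.2.1 h₁.2.2).union h₂.2.2

/-- `[(s, A)]`: the (characteristic functions of the) sets `s ∪ ⋃ D`, for `D ⊆ A` infinite. -/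
def MatetCond.branches (p : MatetCond) : Set (ℕ → Bool) :=
  {X | ∃ D ⊆ p.blocks, D.Infinite ∧
    ∀ n, X n = true ↔ n ∈ p.stem ∨ ∃ a ∈ D, n ∈ a}

/-! ## Names and the forcing relation

The ground model is the universe `PSet` of sets. -/

/-- `P`-names: a name is a set of pairs consisting of a name and a condition. -/
inductive PName (P : Type) : Type (u + 1)
  | mk (ι : Type u) (elt : ι → PName P) (cond : ι → P) : PName P

namespace PName

variable {P : Type}

/-- The canonical name of an element of the ground model: `y̌ = {(ž, p) : z ∈ y, p ∈ P}`. -/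
def check : PSet.{u} → PName.{u} P
  | ⟨α, A⟩ => ⟨α × P, fun i => check (A i.1), fun i => i.2⟩

/-- The canonical name of a natural number. -/
def nat (n : ℕ) : PName.{u} P := check (PSet.ofNat n)

variable [Preorder P]

/-- `p ⊩ x = y`, by recursion: below `p`, whenever an element of one side is present, it is
densely forced to equal an element of the other side which is present. -/
def ForcesEq : PName.{u} P → PName.{u} P → P → Prop
  | ⟨ι, a, c⟩, ⟨κ, b, d⟩, p =>
    (∀ i : ι, ∀ q ≤ p, q ≤ c i → ∃ r ≤ q, ∃ j : κ, r ≤ d j ∧ ForcesEq (a i) (b j) r) ∧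
    (∀ j : κ, ∀ q ≤ p, q ≤ d j → ∃ r ≤ q, ∃ i : ι, r ≤ c i ∧ ForcesEq (a i) (b j) r)

/-- `p ⊩ x ∈ y`. -/
def ForcesMem (x : PName.{u} P) : PName.{u} P → P → Prop
  | ⟨κ, b, d⟩, p => ∀ q ≤ p, ∃ r ≤ q, ∃ j : κ, r ≤ d j ∧ ForcesEq x (b j) r

/-- `p ⊩ x ∉ y`. -/
def ForcesNotMem (x y : PName.{u} P) (p : P) : Prop := ∀ q ≤ p, ¬ ForcesMem x y q

/-- `p ⊩ x ⊆ ω`: `x` is a name for a real (reals are identified with subsets of `ω`). -/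
def ForcesReal (x : PName.{u} P) (p : P) : Prop :=
  ∀ z : PName.{u} P, ∀ q ≤ p, ForcesMem z x q → ForcesMem z (check PSet.omega) q

/-- `p ⊩ x ∉ V`: no extension of `p` forces `x` to equal an element of the ground model. -/
def ForcesNew (x : PName.{u} P) (p : P) : Prop :=
  ∀ y : PSet.{u}, ∀ q ≤ p, ¬ ForcesEq x (check y) q

/-- `p ⊩ σ` is an initial segment of (the characteristic function of) the real `x`. -/
def ForcesInitial (σ : List Bool) (x : PName.{u} P) (p : P) : Prop :=
  ∀ i, (σ[i]? = some true → ForcesMem (nat i) x p) ∧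
    (σ[i]? = some false → ForcesNotMem (nat i) x p)

/-- The name for the value at the real `x` of the canonical reinterpretation, in the generic
extension, of a ground-model continuous function `f : K → 2^ω`. In the extension, `n` belongs to
that value if and only if some finite initial segment `σ` of `x` guarantees it, in the sense that
in the ground model `f y n = 1` for all `y ∈ K` extending `σ`. -/
def image (K : Set (ℕ → Bool)) (f : (ℕ → Bool) → ℕ → Bool) (x : PName.{u} P) : PName.{u} P :=
  ⟨ULift.{u} {c : ℕ × P // ∃ σ : List Bool, ForcesInitial σ x c.2 ∧
      ∀ y ∈ K, (∀ i b, σ[i]? = some b → y i = b) → f y c.1 = true},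
    fun c => nat c.down.1.1, fun c => c.down.1.2⟩

end PName

/-- The name of the Matet generic real `⋃ {s : (s, A) ∈ G}`. -/
def matetReal : PName.{u} MatetCond :=
  ⟨ULift.{u} {c : ℕ × MatetCond // c.1 ∈ c.2.stem},
    fun c => PName.nat c.down.1.1, fun c => c.down.1.2⟩

/-! Hindman's theorem, applied to finite unions of blocks, gives pure decision: every condition has
a pure extension (same stem) deciding a given digit of `x` (`exists_pureLE_decides`). Fusion then
yields a pure extension in which every finite stem `t` carries a guess `X t` for all of `x`: each
digit of `X t` is forced at stem `t` once finitely many blocks are dropped (`exists_guess`).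

For fixed `t`, Hindman's theorem makes the relation `X (t ∪ u) = X t` hold for all nonempty unions
`u` of later blocks or for none. If it held for all, a single condition would decide `x` to be `X
t`, although `x` is new; so it holds for none (`exists_pureLE_guess_ne`). A second fusion arranges
this for all stems and makes stage `k` decide enough digits to separate distinct guesses of the
finitely many stems available by then. With blocks `b 0 < b 1 < ⋯`, the guesses along a set `d` of
indices converge to a real `F d`. This depends continuously on `d`; it is injective, since at the
first difference of `d` and `d'` one stem gains a block and the other does not, which changes the
guess in a digit that is never revised (`exists_coding`).

If `Y d` is the union of the stem and the blocks indexed by `d`, then `F` and `Y` are both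
continuous injections of the compact space `2^ω`, hence embeddings, and the functions sought are `f
= F ∘ Y⁻¹` and `g = Y ∘ F⁻¹`. No generic filter is used: a branch through a condition stands in for
the generic real, and `Reads` says that digits can be decided along it (`forcesEq_image`). -/

namespace PName

/-! ### The forcing relation for equality, membership and digits of reals -/

variable {P : Type} [Preorder P]

theorem ForcesEq.mono {x y : PName.{u} P} {p q : P} (h : ForcesEq x y p) (hq : q ≤ p) :
    ForcesEq x y q := by
  cases x; cases y
  rw [ForcesEq] at h ⊢
  exact ⟨fun i r hr => h.1 i r (hr.trans hq), fun j r hr => h.2 j r (hr.trans hq)⟩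

theorem ForcesEq.refl (x : PName.{u} P) (p : P) : ForcesEq x x p := by
  induction x generalizing p with
  | mk ι a c ih =>
    rw [ForcesEq]
    exact ⟨fun i q _ hc => ⟨q, le_rfl, i, hc, ih i q⟩, fun i q _ hc => ⟨q, le_rfl, i, hc, ih i q⟩⟩

theorem ForcesEq.symm {x y : PName.{u} P} {p : P} (h : ForcesEq x y p) : ForcesEq y x p := by
  induction x generalizing y p with
  | mk ι a c ih =>
    cases y
    rw [ForcesEq] at h ⊢
    refine ⟨fun j q hq hd => ?_, fun i q hq hc => ?_⟩
    · obtain ⟨r, hr, i, hi, he⟩ := h.2 j q hq hd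
      exact ⟨r, hr, i, hi, ih i he⟩
    · obtain ⟨r, hr, j, hj, he⟩ := h.1 i q hq hc
      exact ⟨r, hr, j, hj, ih i he⟩

theorem ForcesEq.trans {x y z : PName.{u} P} {p : P} (h : ForcesEq x y p) (h' : ForcesEq y z p) :
    ForcesEq x z p := by
  induction x generalizing y z p with
  | mk ι a c ih =>
    cases y; cases z
    rw [ForcesEq] at h h' ⊢
    refine ⟨fun i q hq hc => ?_, fun k q hq he => ?_⟩
    · obtain ⟨r, hr, j, hj, e⟩ := h.1 i q hq hc
      obtain ⟨r', hr', k, hk, e'⟩ := h'.1 j r (hr.trans hq) hj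
      exact ⟨r', hr'.trans hr, k, hk, ih i (e.mono hr') e'⟩
    · obtain ⟨r, hr, j, hj, e⟩ := h'.2 k q hq he
      obtain ⟨r', hr', i, hi, e'⟩ := h.2 j r (hr.trans hq) hj
      exact ⟨r', hr'.trans hr, i, hi, ih i e' (e.mono hr')⟩

theorem ForcesMem.mono {x y : PName.{u} P} {p q : P} (h : ForcesMem x y p) (hq : q ≤ p) :
    ForcesMem x y q := by
  cases y
  exact fun r hr => h r (hr.trans hq)

theorem ForcesNotMem.mono {x y : PName.{u} P} {p q : P} (h : ForcesNotMem x y p) (hq : q ≤ p) :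
    ForcesNotMem x y q :=
  fun r hr => h r (hr.trans hq)

theorem forcesMem_of_dense {x y : PName.{u} P} {p : P} (h : ∀ q ≤ p, ∃ r ≤ q, ForcesMem x y r) :
    ForcesMem x y p := by
  cases y
  intro q hq
  obtain ⟨r, hr, hm⟩ := h q hq
  obtain ⟨r', hr', hm'⟩ := hm r le_rfl
  exact ⟨r', hr'.trans hr, hm'⟩

theorem ForcesMem.congr_left {x x' y : PName.{u} P} {p : P} (h : ForcesMem x y p)
    (e : ForcesEq x x' p) : ForcesMem x' y p := by
  cases y
  intro q hq
  obtain ⟨r, hr, j, hj, hm⟩ := h q hq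
  exact ⟨r, hr, j, hj, (e.mono (hr.trans hq)).symm.trans hm⟩

theorem forcesMem_elt {ι : Type u} {a : ι → PName.{u} P} {c : ι → P} {i : ι} {p : P}
    (h : p ≤ c i) : ForcesMem (a i) ⟨ι, a, c⟩ p :=
  fun q hq => ⟨q, le_rfl, i, hq.trans h, ForcesEq.refl _ _⟩

/-- Every condition is attached to every element of a check name, so `p` itself may be paired with
an element of either side; matching then descends by ∈-induction. -/
theorem equiv_of_forcesEq_check {y z : PSet.{u}} {p : P}
    (h : ForcesEq (check y : PName.{u} P) (check z) p) : y.Equiv z := by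
  induction y generalizing z p with
  | mk α A ih =>
    cases z with
    | mk β B =>
      rw [check, check, ForcesEq] at h
      refine ⟨fun i => ?_, fun j => ?_⟩
      · obtain ⟨r, -, j, -, e⟩ := h.1 (i, p) p le_rfl le_rfl
        exact ⟨j.1, ih i e⟩
      · obtain ⟨r, -, i, -, e⟩ := h.2 (j, p) p le_rfl le_rfl
        exact ⟨i.1, ih i.1 e⟩

theorem ofNat_mem_ofNat {m n : ℕ} (h : m < n) : PSet.ofNat.{u} m ∈ PSet.ofNat.{u} n := by
  induction n with
  | zero => omega
  | succ n ih =>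
    rw [PSet.ofNat, PSet.mem_insert_iff]
    rcases Nat.lt_succ_iff_lt_or_eq.1 h with h | rfl
    · exact Or.inr (ih h)
    · exact Or.inl (PSet.Equiv.refl _)

theorem ofNat_injective {m n : ℕ} (h : (PSet.ofNat.{u} m).Equiv (PSet.ofNat.{u} n)) : m = n := by
  rcases lt_trichotomy m n with hl | he | hl
  · exact absurd ((PSet.Mem.congr_right h).2 (ofNat_mem_ofNat hl)) (PSet.mem_irrefl _)
  · exact he
  · exact absurd ((PSet.Mem.congr_right h).1 (ofNat_mem_ofNat hl)) (PSet.mem_irrefl _)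

theorem nat_injective {m n : ℕ} {p : P} (h : ForcesEq (nat m : PName.{u} P) (nat n) p) : m = n :=
  ofNat_injective (equiv_of_forcesEq_check h)

theorem forcesMem_omega_iff {z : PName.{u} P} {p : P} :
    ForcesMem z (check PSet.omega) p ↔ ∀ q ≤ p, ∃ r ≤ q, ∃ n : ℕ, ForcesEq z (nat n) r := by
  refine forall₂_congr fun q _ => ⟨?_, ?_⟩
  · rintro ⟨r, hr, j, -, e⟩
    exact ⟨r, hr, j.1.down, e⟩
  · rintro ⟨r, hr, n, e⟩
    exact ⟨r, hr, (⟨n⟩, r), le_rfl, e⟩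

theorem ForcesReal.mono {x : PName.{u} P} {p q : P} (h : ForcesReal x p) (hq : q ≤ p) :
    ForcesReal x q :=
  fun z r hr => h z r (hr.trans hq)

/-- A name all of whose elements are names of natural numbers is forced to be a real. -/
theorem forcesReal_of_elt_nat {ι : Type u} {n : ι → ℕ} {c : ι → P} (p : P) :
    ForcesReal (⟨ι, fun i => nat (n i), c⟩ : PName.{u} P) p := by
  intro z q _ hz
  rw [forcesMem_omega_iff]
  intro q' hq'
  obtain ⟨r, hr, j, -, e⟩ := hz q' hq'
  exact ⟨r, hr, n j, e⟩

/-- Extensionality for names of reals: only natural numbers have to be tested. -/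
theorem forcesEq_of_forall_nat {x y : PName.{u} P} {p : P} (hx : ForcesReal x p)
    (hy : ForcesReal y p)
    (h : ∀ n, ∀ q ≤ p, ForcesMem (nat n) x q ↔ ForcesMem (nat n) y q) : ForcesEq x y p := by
  have key : ∀ {ι κ : Type u} {a : ι → PName.{u} P} {c : ι → P} {b : κ → PName.{u} P} {d : κ → P},
      ForcesReal ⟨ι, a, c⟩ p →
      (∀ n, ∀ q ≤ p, ForcesMem (nat n) ⟨ι, a, c⟩ q → ForcesMem (nat n) ⟨κ, b, d⟩ q) →
      ∀ i, ∀ q ≤ p, q ≤ c i → ∃ r ≤ q, ∃ j, r ≤ d j ∧ ForcesEq (a i) (b j) r := by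
    intro ι κ a c b d hr h i q hq hi
    -- An element of a name for a real is densely equal to some numeral, which is what the
    -- hypothesis on natural numbers can be applied to.
    have hm := forcesMem_elt (a := a) hi
    obtain ⟨r, hrq, n, e⟩ := forcesMem_omega_iff.1 (hr _ q hq hm) q le_rfl
    obtain ⟨r', hr', j, hj, e'⟩ :=
      h n r (hrq.trans hq) ((hm.mono hrq).congr_left e) r le_rfl
    exact ⟨r', hr'.trans hrq, j, hj, (e.mono hr').trans e'⟩
  cases x; cases y
  rw [ForcesEq]
  refine ⟨key hx fun n q hq => (h n q hq).1, fun j q hq hd => ?_⟩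
  obtain ⟨r, hr, i, hi, e⟩ := key hy (fun n q hq => (h n q hq).2) j q hq hd
  exact ⟨r, hr, i, hi, e.symm⟩

theorem ForcesInitial.mono {σ : List Bool} {x : PName.{u} P} {p q : P} (h : ForcesInitial σ x p)
    (hq : q ≤ p) : ForcesInitial σ x q :=
  fun i => ⟨fun hi => ((h i).1 hi).mono hq, fun hi => ((h i).2 hi).mono hq⟩

theorem forcesMem_image_iff {K : Set (ℕ → Bool)} {f : (ℕ → Bool) → ℕ → Bool} {x : PName.{u} P}
    {n : ℕ} {p : P} :
    ForcesMem (nat n) (image K f x) p ↔ ∀ q ≤ p, ∃ r ≤ q, ∃ σ : List Bool, ForcesInitial σ x r ∧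
      ∀ y ∈ K, (∀ i b, σ[i]? = some b → y i = b) → f y n = true := by
  refine forall₂_congr fun q _ => ⟨?_, ?_⟩
  · rintro ⟨r, hr, ⟨⟨⟨m, c⟩, σ, hσ, hf⟩⟩, hc, e⟩
    obtain rfl := nat_injective e
    exact ⟨r, hr, σ, hσ.mono hc, hf⟩
  · rintro ⟨r, hr, σ, hσ, hf⟩
    exact ⟨r, hr, ⟨⟨(n, r), σ, hσ, hf⟩⟩, le_rfl, ForcesEq.refl _ _⟩

theorem forcesReal_image (K : Set (ℕ → Bool)) (f : (ℕ → Bool) → ℕ → Bool) (x : PName.{u} P)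
    (p : P) : ForcesReal (image K f x) p :=
  forcesReal_of_elt_nat p

/-- `p` decides whether `n` belongs to `x`, and the answer is `b`. -/
def Decides (x : PName.{u} P) (n : ℕ) (b : Prop) (p : P) : Prop :=
  (b → ForcesMem (nat n) x p) ∧ (¬ b → ForcesNotMem (nat n) x p)

theorem Decides.mono {x : PName.{u} P} {n : ℕ} {b : Prop} {p q : P} (h : Decides x n b p)
    (hq : q ≤ p) : Decides x n b q :=
  ⟨fun hb => (h.1 hb).mono hq, fun hb => (h.2 hb).mono hq⟩

theorem Decides.iff_of_le {x : PName.{u} P} {n : ℕ} {b b' : Prop} {p q r : P}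
    (h : Decides x n b p) (h' : Decides x n b' q) (hp : r ≤ p) (hq : r ≤ q) : b ↔ b' := by
  by_cases hb : b <;> by_cases hb' : b' <;> simp only [hb, hb', iff_self]
  · exact absurd ((h.1 hb).mono hp) (h'.2 hb' r hq)
  · exact absurd ((h'.1 hb').mono hq) (h.2 hb r hp)

theorem exists_decides (x : PName.{u} P) (n : ℕ) (p : P) : ∃ q ≤ p, ∃ b, Decides x n b q := by
  by_cases h : ∃ q ≤ p, ForcesMem (nat n) x q
  · obtain ⟨q, hq, hm⟩ := h
    exact ⟨q, hq, True, fun _ => hm, fun h => absurd trivial h⟩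
  · push Not at h
    exact ⟨p, le_rfl, False, fun h => h.elim, fun _ => h⟩

theorem decides_of_dense {x : PName.{u} P} {n : ℕ} {b : Prop} {p : P}
    (h : ∀ q ≤ p, ∃ r ≤ q, Decides x n b r) : Decides x n b p := by
  refine ⟨fun hb => forcesMem_of_dense fun q hq => ?_, fun hb q hq hm => ?_⟩
  · obtain ⟨r, hr, hd⟩ := h q hq
    exact ⟨r, hr, hd.1 hb⟩
  · obtain ⟨r, hr, hd⟩ := h q hq
    exact hd.2 hb r le_rfl (hm.mono hr)

/-- A name of a new real cannot be decided completely by a single condition. -/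
theorem ForcesNew.not_forall_decides {x : PName.{u} P} {p : P} (hr : ForcesReal x p)
    (hn : ForcesNew x p) (X : ℕ → Prop) : ¬ ∀ n, Decides x n (X n) p := by
  intro h
  let y : PSet.{u} := ⟨ULift.{u} {n : ℕ // X n}, fun n => PSet.ofNat n.down.1⟩
  refine hn y p le_rfl (forcesEq_of_forall_nat hr ?_ fun n q hq => ?_)
  · exact forcesReal_of_elt_nat
      (n := fun i : ULift.{u} {n : ℕ // X n} × P => i.1.down.1) (c := fun i => i.2) p
  constructor
  · intro hm
    have hX : X n := by
      by_contra hX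
      exact (h n).2 hX q hq hm
    exact fun r _ => ⟨r, le_rfl, (⟨⟨n, hX⟩⟩, r), le_rfl, ForcesEq.refl _ _⟩
  · intro hm
    obtain ⟨r, -, i, -, e⟩ := hm q le_rfl
    obtain rfl : n = i.1.down.1 := nat_injective e
    exact ((h _).1 i.1.down.2).mono hq

end PName

/-! ### Blocks and their finite unions -/

theorem BlockLT.mono {a a' b b' : Finset ℕ} (h : BlockLT a b) (ha : a' ⊆ a) (hb : b' ⊆ b) :
    BlockLT a' b' :=
  fun i hi j hj => h i (ha hi) j (hb hj)

theorem BlockLT.union_left {a b c : Finset ℕ} (h : BlockLT a c) (h' : BlockLT b c) :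
    BlockLT (a ∪ b) c :=
  fun i hi j hj => (Finset.mem_union.1 hi).elim (fun hi => h i hi j hj) fun hi => h' i hi j hj

theorem BlockLT.union_right {a b c : Finset ℕ} (h : BlockLT a b) (h' : BlockLT a c) :
    BlockLT a (b ∪ c) :=
  fun i hi j hj => (Finset.mem_union.1 hj).elim (fun hj => h i hi j hj) fun hj => h' i hi j hj

theorem IsFiniteUnion.mono {A B : Set (Finset ℕ)} {c : Finset ℕ} (h : IsFiniteUnion A c)
    (hAB : A ⊆ B) : IsFiniteUnion B c :=
  h.trans fun _ ha => .of_mem (hAB ha)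

theorem IsFiniteUnion.exists_mem {A : Set (Finset ℕ)} {c : Finset ℕ} (h : IsFiniteUnion A c)
    {n : ℕ} (hn : n ∈ c) : ∃ a ∈ A, n ∈ a ∧ a ⊆ c := by
  obtain ⟨F, hF, rfl⟩ := h
  obtain ⟨a, ha, hna⟩ := Finset.mem_biUnion.1 hn
  exact ⟨a, hF ha, hna, Finset.subset_biUnion_of_mem id ha⟩

/-- A finite set is a finite union of members of `A` as soon as each of its elements lies in a
member of `A` included in it. -/
theorem IsFiniteUnion.of_forall {A : Set (Finset ℕ)} {c : Finset ℕ}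
    (h : ∀ n ∈ c, ∃ a ∈ A, n ∈ a ∧ a ⊆ c) : IsFiniteUnion A c := by
  classical
  choose! f hf using h
  refine ⟨c.image f, ?_, ?_⟩
  · intro a ha
    obtain ⟨n, hn, rfl⟩ := Finset.mem_image.1 (Finset.mem_coe.1 ha)
    exact (hf n hn).1
  · ext n
    simp only [Finset.mem_biUnion, Finset.mem_image, id, exists_exists_and_eq_and]
    exact ⟨fun hn => ⟨n, hn, (hf n hn).2.1⟩, fun ⟨m, hm, hn⟩ => (hf m hm).2.2 hn⟩

/-! ### Pure extensions and restrictions of conditions -/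

namespace MatetCond

theorem eq_of_mem {p : MatetCond} {a b : Finset ℕ} (ha : a ∈ p.blocks) (hb : b ∈ p.blocks) {i : ℕ}
    (hia : i ∈ a) (hib : i ∈ b) : a = b := by
  by_contra h
  rcases p.ordered a ha b hb h with h | h
  · exact lt_irrefl _ (h i hia i hib)
  · exact lt_irrefl _ (h i hib i hia)

/-- A block not above `e` has its minimum at most `max e`, and distinct blocks, being disjoint, have
distinct minima. -/
theorem finite_not_blockLT (p : MatetCond) (e : Finset ℕ) :
    {a ∈ p.blocks | ¬ BlockLT e a}.Finite := by
  refine Set.Finite.of_finite_image (f := fun a : Finset ℕ => sInf (a : Set ℕ)) ?_ ?_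
  · refine (Set.finite_Iic (e.sup id)).subset ?_
    rintro _ ⟨a, ⟨-, ha⟩, rfl⟩
    simp only [BlockLT, not_forall, not_lt] at ha
    obtain ⟨i, hi, j, hj, hij⟩ := ha
    exact (Nat.sInf_le (by exact_mod_cast hj)).trans (hij.trans (Finset.le_sup (f := id) hi))
  · intro a ha b hb hab
    have hma := Nat.sInf_mem (s := (a : Set ℕ)) (by exact_mod_cast p.nonempty a ha.1)
    have hmb := Nat.sInf_mem (s := (b : Set ℕ)) (by exact_mod_cast p.nonempty b hb.1)
    dsimp only at hab
    rw [← hab] at hmb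
    exact eq_of_mem ha.1 hb.1 hma hmb

theorem exists_blockLT_of_infinite (p : MatetCond) {D : Set (Finset ℕ)} (hD : D ⊆ p.blocks)
    (hi : D.Infinite) (e : Finset ℕ) : ∃ a ∈ D, BlockLT e a := by
  by_contra! h
  exact hi ((p.finite_not_blockLT e).subset fun a ha => ⟨hD ha, h a ha⟩)

theorem exists_blockLT (p : MatetCond) (e : Finset ℕ) : ∃ a ∈ p.blocks, BlockLT e a :=
  p.exists_blockLT_of_infinite subset_rfl p.infinite e

theorem infinite_of_forall_exists {A : Set (Finset ℕ)} (hne : ∀ a ∈ A, a.Nonempty)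
    (h : ∀ e, ∃ a ∈ A, BlockLT e a) : A.Infinite := by
  intro hf
  obtain ⟨a, ha, hlt⟩ := h (hf.toFinset.biUnion id)
  obtain ⟨i, hi⟩ := hne a ha
  exact lt_irrefl _ (hlt i (Finset.mem_biUnion.2 ⟨a, hf.mem_toFinset.2 ha, hi⟩) i hi)

theorem blockLT_stem_of_isFiniteUnion {p : MatetCond} {t : Finset ℕ}
    (h : IsFiniteUnion p.blocks t) : BlockLT p.stem t := by
  intro i hi j hj
  obtain ⟨a, ha, hja, -⟩ := h.exists_mem hj
  exact p.stem_lt a ha i hi j hja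

theorem union_sdiff_stem {p : MatetCond} {t : Finset ℕ} (h : IsFiniteUnion p.blocks t) :
    (p.stem ∪ t) \ p.stem = t := by
  ext n
  simp only [Finset.mem_sdiff, Finset.mem_union]
  refine ⟨fun h' => h'.1.resolve_left h'.2, fun hn => ⟨Or.inr hn, fun hs => ?_⟩⟩
  exact lt_irrefl _ (blockLT_stem_of_isFiniteUnion h n hs n hn)

/-- `q` is a pure extension of `p`: it extends `p` and has the same stem. -/
def PureLE (q p : MatetCond) : Prop := q ≤ p ∧ q.stem = p.stem

theorem PureLE.refl (p : MatetCond) : PureLE p p := ⟨le_rfl, rfl⟩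

theorem PureLE.trans {r q p : MatetCond} (h : PureLE r q) (h' : PureLE q p) : PureLE r p :=
  ⟨h.1.trans h'.1, h.2.trans h'.2⟩

theorem pureLE_of_blocks {q p : MatetCond} (hs : q.stem = p.stem)
    (hb : ∀ b ∈ q.blocks, IsFiniteUnion p.blocks b) : PureLE q p :=
  ⟨⟨hs.ge, hb, by simpa [hs] using IsFiniteUnion.empty _⟩, hs⟩

/-- Add `t` to the stem of `p`, and keep only the blocks that lie above both `t` and `e`. -/
def restrict (p : MatetCond) (t e : Finset ℕ) : MatetCond where
  stem := p.stem ∪ t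
  blocks := {a ∈ p.blocks | BlockLT (t ∪ e) a}
  infinite := infinite_of_forall_exists (fun a ha => p.nonempty a ha.1) fun e' => by
    obtain ⟨a, ha, h⟩ := p.exists_blockLT (t ∪ e ∪ e')
    exact ⟨a, ⟨ha, h.mono Finset.subset_union_left subset_rfl⟩,
      h.mono Finset.subset_union_right subset_rfl⟩
  nonempty := fun a ha => p.nonempty a ha.1
  ordered := fun a ha b hb => p.ordered a ha.1 b hb.1
  stem_lt := fun a ha => (p.stem_lt a ha.1).union_left (ha.2.mono Finset.subset_union_left subset_rfl)

@[simp] theorem restrict_stem (p : MatetCond) (t e : Finset ℕ) :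
    (p.restrict t e).stem = p.stem ∪ t := rfl

theorem restrict_le {p : MatetCond} {t : Finset ℕ} (h : IsFiniteUnion p.blocks t)
    (e : Finset ℕ) : p.restrict t e ≤ p := by
  refine ⟨Finset.subset_union_left, fun b hb => .of_mem hb.1, ?_⟩
  rw [restrict_stem, union_sdiff_stem h]
  exact h

theorem restrict_empty_pureLE (p : MatetCond) (e : Finset ℕ) : PureLE (p.restrict ∅ e) p :=
  ⟨restrict_le (.empty _) e, by simp⟩

/-- If a finite union of blocks lies above `c`, it is a finite union of blocks above `c`. -/
theorem isFiniteUnion_above {A : Set (Finset ℕ)} {c b : Finset ℕ} (hb : IsFiniteUnion A b)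
    (hc : BlockLT c b) : IsFiniteUnion {a ∈ A | BlockLT c a} b := by
  refine .of_forall fun n hn => ?_
  obtain ⟨a, ha, hna, hab⟩ := hb.exists_mem hn
  exact ⟨a, ⟨ha, hc.mono subset_rfl hab⟩, hna, hab⟩

/-- Only blocks above `e` survive the restriction, so the others need not be unions of blocks of
`p`. Fusion needs this: blocks chosen early are not unions of blocks of later stages. -/
theorem restrict_pureLE_restrict {q p : MatetCond} {e : Finset ℕ} (hs : q.stem = p.stem)
    (hb : ∀ b ∈ q.blocks, BlockLT e b → IsFiniteUnion p.blocks b) (t : Finset ℕ) :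
    PureLE (q.restrict t e) (p.restrict t e) := by
  refine pureLE_of_blocks (by simp [hs]) fun b h => ?_
  exact isFiniteUnion_above (hb b h.1 (h.2.mono Finset.subset_union_right subset_rfl)) h.2

theorem PureLE.restrict {q p : MatetCond} (h : PureLE q p) (t e : Finset ℕ) :
    PureLE (q.restrict t e) (p.restrict t e) :=
  restrict_pureLE_restrict h.2 (fun b hb _ => h.1.2.1 b hb) t

theorem restrict_anti (p : MatetCond) (t : Finset ℕ) {e e' : Finset ℕ} (h : e ⊆ e') :
    p.restrict t e' ≤ p.restrict t e :=
  (pureLE_of_blocks (q := p.restrict t e') (p := p.restrict t e) rfl fun _ hb => .of_mem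
    ⟨hb.1, hb.2.mono (Finset.union_subset_union_right h) subset_rfl⟩).1

theorem stem_union_sdiff {r q : MatetCond} (h : r ≤ q) : q.stem ∪ (r.stem \ q.stem) = r.stem :=
  Finset.union_sdiff_of_subset h.1

/-- Transfers to `r` whatever `q` forces at the stem of `r` after dropping the blocks not above `e`.
-/
theorem restrict_le_restrict_sdiff {r q : MatetCond} (h : r ≤ q) (e : Finset ℕ) :
    r.restrict ∅ e ≤ q.restrict (r.stem \ q.stem) e := by
  refine (pureLE_of_blocks (by simp [stem_union_sdiff h]) fun b hb => ?_).1
  refine isFiniteUnion_above (h.2.1 b hb.1) (.union_left ?_ ?_)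
  · exact (r.stem_lt b hb.1).mono Finset.sdiff_subset subset_rfl
  · exact hb.2.mono Finset.subset_union_right subset_rfl

/-- If no block of `q` is cut by `e`, an extension of `q` whose blocks lie above `e` extends the
restriction of `q` given by the part of its stem inside `e`. -/
theorem le_restrict_inter {r q : MatetCond} (h : r ≤ q) {e : Finset ℕ}
    (hq : ∀ a ∈ q.blocks, a ⊆ e ∨ BlockLT e a) (hr : ∀ a ∈ r.blocks, BlockLT e a) :
    r ≤ q.restrict ((r.stem \ q.stem) ∩ e) e := by
  have he : (r.stem \ q.stem) ∩ e ∪ e = e := Finset.union_eq_right.2 Finset.inter_subset_right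
  refine ⟨?_, fun b hb => ?_, .of_forall fun n hn => ?_⟩
  · exact Finset.union_subset h.1 (Finset.inter_subset_left.trans Finset.sdiff_subset)
  · refine isFiniteUnion_above (h.2.1 b hb) ?_
    rw [he]
    exact hr b hb
  · simp only [restrict_stem, Finset.mem_sdiff, Finset.mem_union, Finset.mem_inter, not_or,
      not_and] at hn
    obtain ⟨hnr, hnq, hn⟩ := hn
    have hne := hn ⟨hnr, hnq⟩
    obtain ⟨a, ha, hna, har⟩ := h.2.2.exists_mem (Finset.mem_sdiff.2 ⟨hnr, hnq⟩)
    have hea : BlockLT e a := (hq a ha).resolve_left fun hae => hne (hae hna)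
    refine ⟨a, ⟨ha, he.symm ▸ hea⟩, hna, fun i hi => ?_⟩
    have hi' := Finset.mem_sdiff.1 (har hi)
    simp only [restrict_stem, Finset.mem_sdiff, Finset.mem_union, Finset.mem_inter]
    refine ⟨hi'.1, ?_⟩
    rintro (hs | ⟨-, hie⟩)
    · exact hi'.2 hs
    · exact lt_irrefl _ (hea i hie i hi)

/-- Every extension of `q` can be extended to one whose stem is longer than that of `q`. -/
theorem exists_le_sdiff_nonempty {r q : MatetCond} (h : r ≤ q) :
    ∃ r' ≤ r, (r'.stem \ q.stem).Nonempty := by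
  obtain ⟨a, ha, -⟩ := r.exists_blockLT ∅
  refine ⟨r.restrict a ∅, restrict_le (.of_mem ha) _, ?_⟩
  obtain ⟨i, hi⟩ := r.nonempty a ha
  refine ⟨i, Finset.mem_sdiff.2 ⟨Finset.mem_union_right _ hi, fun hq => ?_⟩⟩
  exact lt_irrefl _ (r.stem_lt a ha i (h.1 hq) i hi)

/-! ### Branches -/

/-- The witness `D` can always be taken to be the set of all blocks included in `X`; its infinitude
means that it has members above every finite set. -/
theorem mem_branches_iff {p : MatetCond} {X : ℕ → Bool} :
    X ∈ p.branches ↔ (∀ n ∈ p.stem, X n = true) ∧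
      (∀ n, X n = true → n ∈ p.stem ∨ ∃ a ∈ p.blocks, n ∈ a ∧ ∀ i ∈ a, X i = true) ∧
      ∀ e, ∃ a ∈ p.blocks, BlockLT e a ∧ ∀ i ∈ a, X i = true := by
  constructor
  · rintro ⟨D, hD, hi, hX⟩
    have hDX : ∀ a ∈ D, ∀ i ∈ a, X i = true := fun a ha i hia => (hX i).2 (Or.inr ⟨a, ha, hia⟩)
    refine ⟨fun n hn => (hX n).2 (Or.inl hn), fun n hn => ?_, fun e => ?_⟩
    · exact ((hX n).1 hn).imp_right fun ⟨a, ha, hna⟩ => ⟨a, hD ha, hna, hDX a ha⟩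
    · obtain ⟨a, ha, hlt⟩ := p.exists_blockLT_of_infinite hD hi e
      exact ⟨a, hD ha, hlt, hDX a ha⟩
  · rintro ⟨hs, hb, hi⟩
    refine ⟨{a ∈ p.blocks | ∀ i ∈ a, X i = true}, fun a ha => ha.1, ?_, fun n => ⟨fun hn => ?_, ?_⟩⟩
    · refine infinite_of_forall_exists (fun a ha => p.nonempty a ha.1) fun e => ?_
      obtain ⟨a, ha, hlt, haX⟩ := hi e
      exact ⟨a, ⟨ha, haX⟩, hlt⟩
    · exact (hb n hn).imp_right fun ⟨a, ha, hna, haX⟩ => ⟨a, ⟨ha, haX⟩, hna⟩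
    · rintro (hn | ⟨a, ha, hna⟩)
      · exact hs n hn
      · exact ha.2 n hna

theorem branches_nonempty (p : MatetCond) : p.branches.Nonempty := by
  classical
  exact ⟨fun n => decide (n ∈ p.stem ∨ ∃ a ∈ p.blocks, n ∈ a), p.blocks, subset_rfl, p.infinite,
    fun n => by simp⟩

theorem branches_mono {r q : MatetCond} (h : r ≤ q) : r.branches ⊆ q.branches := by
  intro X hX
  rw [mem_branches_iff] at hX ⊢
  obtain ⟨hs, hb, hi⟩ := hX
  refine ⟨fun n hn => hs n (h.1 hn), fun n hn => ?_, fun e => ?_⟩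
  · rcases hb n hn with hn | ⟨b, hb, hnb, hbX⟩
    · by_cases hq : n ∈ q.stem
      · exact Or.inl hq
      · obtain ⟨a, ha, hna, har⟩ := h.2.2.exists_mem (Finset.mem_sdiff.2 ⟨hn, hq⟩)
        exact Or.inr ⟨a, ha, hna, fun i hi => hs i (Finset.mem_sdiff.1 (har hi)).1⟩
    · obtain ⟨a, ha, hna, hab⟩ := (h.2.1 b hb).exists_mem hnb
      exact Or.inr ⟨a, ha, hna, fun i hi => hbX i (hab hi)⟩
  · obtain ⟨b, hb, hlt, hbX⟩ := hi e
    obtain ⟨n, hn⟩ := r.nonempty b hb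
    obtain ⟨a, ha, -, hab⟩ := (h.2.1 b hb).exists_mem hn
    exact ⟨a, ha, hlt.mono subset_rfl hab, fun i hi => hbX i (hab hi)⟩

theorem mem_stem_iff_of_mem_branches {p : MatetCond} {X : ℕ → Bool} (hX : X ∈ p.branches)
    {e : Finset ℕ} (he : ∀ a ∈ p.blocks, BlockLT e a) {i : ℕ} (hi : i ∈ e) :
    i ∈ p.stem ↔ X i = true := by
  rw [mem_branches_iff] at hX
  refine ⟨hX.1 i, fun h => (hX.2.1 i h).resolve_right ?_⟩
  rintro ⟨a, ha, hia, -⟩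
  exact lt_irrefl _ (he a ha i hi i hia)

/-- A condition can be extended along a given branch so that its blocks lie above `e`. -/
theorem exists_le_mem_branches {p : MatetCond} {X : ℕ → Bool} (hX : X ∈ p.branches)
    (e : Finset ℕ) : ∃ q ≤ p, X ∈ q.branches ∧ ∀ a ∈ q.blocks, BlockLT e a := by
  have hX' := mem_branches_iff.1 hX
  obtain ⟨hs, hb, hi⟩ := hX'
  -- The stem is to absorb the blocks of `X` that are not entirely above `e`; there are finitely
  -- many.
  have hfin : {a ∈ p.blocks | ¬ BlockLT e a ∧ ∀ i ∈ a, X i = true}.Finite :=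
    (p.finite_not_blockLT e).subset fun a ha => ⟨ha.1, ha.2.1⟩
  set t : Finset ℕ := hfin.toFinset.biUnion id with ht
  have hmem : ∀ n, n ∈ t ↔ ∃ a ∈ p.blocks, ¬ BlockLT e a ∧ (∀ i ∈ a, X i = true) ∧ n ∈ a := by
    intro n
    simp only [ht, Finset.mem_biUnion, Set.Finite.mem_toFinset, Set.mem_ofPred_eq, id, and_assoc]
  have htu : IsFiniteUnion p.blocks t := ⟨hfin.toFinset, fun a ha => by
    rw [Set.Finite.coe_toFinset] at ha
    exact ha.1, rfl⟩
  refine ⟨p.restrict t e, restrict_le htu e, ?_,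
    fun a ha => ha.2.mono Finset.subset_union_right subset_rfl⟩
  rw [mem_branches_iff]
  refine ⟨fun n hn => ?_, fun n hn => ?_, fun e' => ?_⟩
  · rcases Finset.mem_union.1 hn with hn | hn
    · exact hs n hn
    · obtain ⟨a, -, -, haX, hna⟩ := (hmem n).1 hn
      exact haX n hna
  · rcases hb n hn with hn | ⟨a, ha, hna, haX⟩
    · exact Or.inl (Finset.mem_union_left _ hn)
    · by_cases hea : BlockLT e a
      · refine Or.inr ⟨a, ⟨ha, .union_left ?_ hea⟩, hna, haX⟩
        intro i hi j hj
        obtain ⟨d, hd, hed, -, hid⟩ := (hmem i).1 hi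
        have hne : d ≠ a := by
          rintro rfl
          exact hed hea
        -- The absorbed block `d` lies below `a`: otherwise `e < a < d` would put `d` above `e`.
        rcases p.ordered d hd a ha hne with h | h
        · exact h i hid j hj
        · exact absurd (fun k hk l hl => (hea k hk j hj).trans (h j hj l hl)) hed
      · exact Or.inl (Finset.mem_union_right _ ((hmem n).2 ⟨a, ha, hea, haX, hna⟩))
  · obtain ⟨a, ha, hlt, haX⟩ := hi (t ∪ e ∪ e')
    exact ⟨a, ⟨ha, hlt.mono Finset.subset_union_left subset_rfl⟩,
      hlt.mono Finset.subset_union_right subset_rfl, haX⟩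

/-! ### Conditions given by increasing sequences of blocks -/

/-- The condition `(s, {b 0 < b 1 < ⋯})`. -/
def ofSeq (s : Finset ℕ) (b : ℕ → Finset ℕ) (hne : ∀ i, (b i).Nonempty)
    (hlt : ∀ i j, i < j → BlockLT (b i) (b j)) (hs : ∀ i, BlockLT s (b i)) : MatetCond where
  stem := s
  blocks := Set.range b
  infinite := Set.infinite_range_of_injective fun i j hij => by
    by_contra h
    obtain ⟨n, hn⟩ := hne i
    rcases lt_or_gt_of_ne h with h | h
    · exact lt_irrefl _ (hlt i j h n hn n (hij ▸ hn))
    · exact lt_irrefl _ (hlt j i h n (hij ▸ hn) n hn)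
  nonempty := by
    rintro _ ⟨i, rfl⟩
    exact hne i
  ordered := by
    rintro _ ⟨i, rfl⟩ _ ⟨j, rfl⟩ h
    rcases lt_trichotomy i j with hij | rfl | hij
    · exact Or.inl (hlt i j hij)
    · exact absurd rfl h
    · exact Or.inr (hlt j i hij)
  stem_lt := by
    rintro _ ⟨i, rfl⟩
    exact hs i

theorem exists_seq (p : MatetCond) :
    ∃ c : ℕ → Finset ℕ, (∀ i, c i ∈ p.blocks) ∧ ∀ i j, i < j → BlockLT (c i) (c j) := by
  choose f hf using p.exists_blockLT
  let e : ℕ → Finset ℕ := fun n => n.rec ∅ fun _ e => e ∪ f e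
  have he : Monotone e := monotone_nat_of_le_succ fun n => Finset.subset_union_left
  refine ⟨fun n => f (e n), fun i => (hf _).1, fun i j hij => (hf (e j)).2.mono ?_ subset_rfl⟩
  exact Finset.subset_union_right.trans (he (Nat.succ_le_of_lt hij))

end MatetCond

/-! ### Hindman's theorem for blocks -/

open Classical in
/-- Finite sets of natural numbers with the partial operation of union of `a < b`, made total by
an absorbing element. -/
noncomputable def blockMul : Option (Finset ℕ) → Option (Finset ℕ) → Option (Finset ℕ)
  | some a, some b => if BlockLT a b then some (a ∪ b) else none
  | _, _ => none

theorem blockMul_some {a b : Finset ℕ} (h : BlockLT a b) :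
    blockMul (some a) (some b) = some (a ∪ b) := by
  simp [blockMul, h]

theorem blockLT_of_blockMul {a b c : Finset ℕ} (h : blockMul (some a) (some b) = some c) :
    BlockLT a b := by
  by_contra hn
  simp [blockMul, hn] at h

/-- The semigroup with the operation `blockMul`. -/
def BlockSemigroup : Type := Option (Finset ℕ)

noncomputable instance : Semigroup BlockSemigroup where
  mul := blockMul
  mul_assoc := by
    rintro (_ | a) (_ | b) (_ | c)
    · rfl
    · rfl
    · rfl
    · rfl
    · rfl
    · rfl
    · show blockMul (blockMul (some a) (some b)) none = none
      cases blockMul (some a) (some b) <;> rfl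
    · show blockMul (blockMul (some a) (some b)) (some c)
        = blockMul (some a) (blockMul (some b) (some c))
      by_cases hab : BlockLT a b <;> by_cases hbc : BlockLT b c
      · rw [blockMul_some hab, blockMul_some hbc]
        by_cases hac : BlockLT a c
        · rw [blockMul_some (hac.union_left hbc), blockMul_some (hab.union_right hac),
            Finset.union_assoc]
        · have h1 : ¬ BlockLT (a ∪ b) c :=
            fun h => hac (h.mono Finset.subset_union_left subset_rfl)
          have h2 : ¬ BlockLT a (b ∪ c) :=
            fun h => hac (h.mono subset_rfl Finset.subset_union_right)
          simp [blockMul, h1, h2]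
      · have h1 : ¬ BlockLT (a ∪ b) c :=
          fun h => hbc (h.mono Finset.subset_union_right subset_rfl)
        simp [blockMul, hab, hbc, h1]
      · have h2 : ¬ BlockLT a (b ∪ c) :=
          fun h => hab (h.mono subset_rfl Finset.subset_union_left)
        simp [blockMul, hab, hbc, h2]
      · simp [blockMul, hab, hbc]

namespace BlockSemigroup

/-- A finite set as an element of the semigroup. -/
def of (a : Finset ℕ) : BlockSemigroup := some a

theorem of_injective {a b : Finset ℕ} (h : of a = of b) : a = b := Option.some.inj h

theorem of_mul {a b : Finset ℕ} (h : BlockLT a b) : of a * of b = of (a ∪ b) := blockMul_some h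

theorem blockLT_of_mul {a b c : Finset ℕ} (h : of a * of b = of c) : BlockLT a b :=
  blockLT_of_blockMul h

/-- The products in `FP` take their factors with increasing indices, so for increasing blocks they
never reach the absorbing element. -/
theorem exists_of_mem_FP {s : Stream' BlockSemigroup} {m : BlockSemigroup}
    (hm : m ∈ Hindman.FP s) (c : ℕ → Finset ℕ) (hs : ∀ n, s.get n = of (c n))
    (hne : ∀ i, (c i).Nonempty) (hlt : ∀ i j, i < j → BlockLT (c i) (c j)) :
    ∃ u, m = of u ∧ u.Nonempty ∧ IsFiniteUnion (Set.range c) u := by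
  induction hm generalizing c with
  | head' s => exact ⟨c 0, hs 0, hne 0, .of_mem ⟨0, rfl⟩⟩
  | tail' s m _ ih =>
    obtain ⟨u, rfl, hu, hf⟩ := ih (fun n => c (n + 1)) (fun n => hs (n + 1)) (fun i => hne _)
      fun i j hij => hlt _ _ (by omega)
    refine ⟨u, rfl, hu, hf.mono ?_⟩
    rintro _ ⟨n, rfl⟩
    exact ⟨n + 1, rfl⟩
  | cons' s m _ ih =>
    obtain ⟨u, rfl, hu, hf⟩ := ih (fun n => c (n + 1)) (fun n => hs (n + 1)) (fun i => hne _)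
      fun i j hij => hlt _ _ (by omega)
    refine ⟨c 0 ∪ u, ?_, hu.mono Finset.subset_union_right, .union (.of_mem ⟨0, rfl⟩) (hf.mono ?_)⟩
    · have h0 : s.head = of (c 0) := hs 0
      rw [h0, of_mul]
      intro i hi j hj
      obtain ⟨_, ⟨n, rfl⟩, hjn, -⟩ := hf.exists_mem hj
      exact hlt 0 (n + 1) (by omega) i hi j hjn
    · rintro _ ⟨n, rfl⟩
      exact ⟨n + 1, rfl⟩

/-- The shift by `n` is there for the induction: the least index of `I` supplies the head of a
dropped stream, and the remaining indices lie in its tail. -/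
theorem of_biUnion_mem_FP {s : Stream' BlockSemigroup} (d : ℕ → Finset ℕ)
    (hs : ∀ n, s.get n = of (d n)) (hlt : ∀ i j, i < j → BlockLT (d i) (d j))
    (I : Finset ℕ) (hI : I.Nonempty) (n : ℕ) (hn : ∀ i ∈ I, n ≤ i) :
    of (I.biUnion d) ∈ Hindman.FP (s.drop n) := by
  induction I using Finset.induction_on_min generalizing n with
  | empty => exact absurd hI (by simp)
  | insert a I ha ih =>
    have hna : n ≤ a := hn a (Finset.mem_insert_self _ _)
    have hsub : Hindman.FP (s.drop a) ⊆ Hindman.FP (s.drop n) := by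
      have h := Hindman.FP_drop_subset_FP (s.drop n) (a - n)
      rwa [Stream'.drop_drop, Nat.add_sub_cancel' hna] at h
    have hhead : (s.drop a).head = of (d a) := by
      rw [← hs a]
      simp
    apply hsub
    rw [Finset.biUnion_insert]
    rcases I.eq_empty_or_nonempty with rfl | hI
    · rw [Finset.biUnion_empty, Finset.union_empty, ← hhead]
      exact Hindman.FP.head' _
    · have h := ih hI (a + 1) fun i hi => ha i hi
      rw [← of_mul, ← hhead]
      · refine Hindman.FP.cons' _ _ ?_
        rwa [Stream'.tail_drop']
      · intro i hi j hj
        obtain ⟨k, hk, hjk⟩ := Finset.mem_biUnion.1 hj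
        exact hlt a k (ha k hk) i hi j hjk

end BlockSemigroup

namespace MatetCond

/-- Hindman's theorem: a property of finite unions of blocks is homogeneous on the nonempty
finite unions of blocks of a pure extension. -/
theorem exists_homogeneous (p : MatetCond) (Q : Finset ℕ → Prop) :
    ∃ q, PureLE q p ∧ ((∀ u, u.Nonempty → IsFiniteUnion q.blocks u → Q u) ∨
      ∀ u, u.Nonempty → IsFiniteUnion q.blocks u → ¬ Q u) := by
  classical
  obtain ⟨c, hc, hclt⟩ := p.exists_seq
  have hcne : ∀ i, (c i).Nonempty := fun i => p.nonempty _ (hc i)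
  let s : Stream' BlockSemigroup := fun n => BlockSemigroup.of (c n)
  -- The two colour classes, indexed by the truth value of `Q`.
  let C : Prop → Set BlockSemigroup := fun b =>
    {m ∈ Hindman.FP s | ∃ u, m = BlockSemigroup.of u ∧ (Q u ↔ b)}
  obtain ⟨_, ⟨b, rfl⟩, s', hs'⟩ := Hindman.FP_partition_regular s (Set.range C)
    (Set.finite_range C) fun m hm => by
      obtain ⟨u, rfl, -⟩ := BlockSemigroup.exists_of_mem_FP hm c (fun _ => rfl) hcne hclt
      exact ⟨C (Q u), ⟨_, rfl⟩, hm, u, rfl, Iff.rfl⟩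
  have hC : ∀ m ∈ Hindman.FP s', ∃ u, m = BlockSemigroup.of u ∧ u.Nonempty ∧
      IsFiniteUnion p.blocks u ∧ (Q u ↔ b) := by
    intro m hm
    obtain ⟨hms, u, rfl, hu⟩ := hs' hm
    obtain ⟨u', he, hne, hf⟩ := BlockSemigroup.exists_of_mem_FP hms c (fun _ => rfl) hcne hclt
    obtain rfl := BlockSemigroup.of_injective he
    exact ⟨u, rfl, hne, hf.mono (Set.range_subset_iff.2 hc), hu⟩
  choose d hd hdne hdf _ using fun n => hC _ (Hindman.FP.singleton s' n)
  have hdlt : ∀ i j, i < j → BlockLT (d i) (d j) := by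
    intro i j hij
    -- The product of two terms of the homogeneous stream is not absorbing, which forces the blocks
    -- to be ordered.
    obtain ⟨u, hu, -⟩ := hC _ (Hindman.FP.mul_two s' i j hij)
    rw [hd, hd] at hu
    exact BlockSemigroup.blockLT_of_mul hu
  refine ⟨ofSeq p.stem d hdne hdlt fun i => blockLT_stem_of_isFiniteUnion (hdf i),
    pureLE_of_blocks rfl ?_, ?_⟩
  · rintro _ ⟨i, rfl⟩
    exact hdf i
  have key : ∀ u, u.Nonempty → IsFiniteUnion (Set.range d) u → (Q u ↔ b) := by
    rintro u hu ⟨F, hF, rfl⟩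
    obtain ⟨I, -, rfl⟩ := Finset.subset_set_image_iff.1 (Set.image_univ ▸ hF)
    rw [Finset.image_biUnion] at hu ⊢
    have hI : I.Nonempty := by
      rw [Finset.nonempty_iff_ne_empty]
      rintro rfl
      simp at hu
    obtain ⟨u, he, -, -, hQ⟩ :=
      hC _ (BlockSemigroup.of_biUnion_mem_FP (s := s') d hd hdlt I hI 0 fun _ _ => Nat.zero_le _)
    have := BlockSemigroup.of_injective he
    rw [← this] at hQ
    exact hQ
  by_cases hb : b
  · exact Or.inl fun u hu hf => (key u hu hf).2 hb
  · exact Or.inr fun u hu hf hQ => hb ((key u hu hf).1 hQ)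

/-! ### Fusion -/

theorem exists_pureLE_forall_restrict {p : MatetCond} {Φ : MatetCond → Prop}
    (hmono : ∀ r r', r ≤ p → PureLE r' r → Φ r → Φ r')
    (hex : ∀ r ≤ p, ∃ r', PureLE r' r ∧ Φ r') {r : MatetCond} (hr : PureLE r p) (e : Finset ℕ)
    (T : Finset (Finset ℕ)) (hT : ∀ t ∈ T, IsFiniteUnion p.blocks t) :
    ∃ r', PureLE r' r ∧ ∀ t ∈ T, Φ (r'.restrict t e) := by
  induction T using Finset.induction_on with
  | empty => exact ⟨r, .refl r, by simp⟩
  | insert t T _ ih =>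
    obtain ⟨r₁, h₁, hΦ⟩ := ih fun t ht => hT t (Finset.mem_insert_of_mem ht)
    have hle : ∀ t' ∈ insert t T, r₁.restrict t' e ≤ p := fun t' ht =>
      ((h₁.trans hr).restrict t' e).1.trans (restrict_le (hT _ ht) e)
    obtain ⟨r₂, h₂, hΦ₂⟩ := hex _ (hle t (Finset.mem_insert_self _ _))
    -- The improved blocks are put back on the old stem; restricting by `t` again gives a pure
    -- extension of `r₂`.
    let r₃ : MatetCond := ⟨r₁.stem, r₂.blocks, r₂.infinite, r₂.nonempty, r₂.ordered,
      fun a ha => (r₂.stem_lt a ha).mono (by rw [h₂.2]; exact Finset.subset_union_left) subset_rfl⟩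
    have h₃ : PureLE r₃ r₁ := pureLE_of_blocks rfl fun b hb =>
      (h₂.1.2.1 b hb).mono fun a ha => ha.1
    refine ⟨r₃, h₃.trans h₁, fun t' ht' => ?_⟩
    rcases Finset.mem_insert.1 ht' with rfl | ht'
    · refine hmono r₂ _ (h₂.1.trans (hle t' (Finset.mem_insert_self _ _))) ?_ hΦ₂
      exact pureLE_of_blocks h₂.2.symm fun b hb => .of_mem hb.1
    · exact hmono _ _ (hle t' (Finset.mem_insert_of_mem ht')) (h₃.restrict t' e) (hΦ t' ht')

/-- Fusion: a property that can be achieved by pure extensions, and is inherited by them, can be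
achieved simultaneously for all the finite stems of a pure extension. -/
theorem fusion {p : MatetCond} {Φ : Finset ℕ → MatetCond → Prop}
    (hmono : ∀ e r r', r ≤ p → PureLE r' r → Φ e r → Φ e r')
    (hex : ∀ e, ∀ r ≤ p, ∃ r', PureLE r' r ∧ Φ e r') :
    ∃ (q : MatetCond) (b : ℕ → Finset ℕ), PureLE q p ∧ q.blocks = Set.range b ∧
      (∀ i j, i < j → BlockLT (b i) (b j)) ∧
      ∀ k, ∀ t ⊆ (Finset.range k).biUnion b, IsFiniteUnion p.blocks t →
        Φ ((Finset.range k).biUnion b) (q.restrict t ((Finset.range k).biUnion b)) := by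
  classical
  have step : ∀ S : {r // PureLE r p} × Finset ℕ, ∃ (r' : {r // PureLE r p}) (b : Finset ℕ),
      PureLE r'.1 S.1.1 ∧ b ∈ r'.1.blocks ∧ BlockLT S.2 b ∧
      ∀ t ⊆ S.2, IsFiniteUnion p.blocks t → Φ S.2 (r'.1.restrict t S.2) := by
    rintro ⟨⟨r, hr⟩, e⟩
    obtain ⟨r', hr', hΦ⟩ := exists_pureLE_forall_restrict (hmono e) (hex e) hr e
      (e.powerset.filter fun t => IsFiniteUnion p.blocks t) fun t ht => (Finset.mem_filter.1 ht).2
    obtain ⟨b, hb, hlt⟩ := r'.exists_blockLT e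
    exact ⟨⟨r', hr'.trans hr⟩, b, hr', hb, hlt, fun t ht hf =>
      hΦ t (Finset.mem_filter.2 ⟨Finset.mem_powerset.2 ht, hf⟩)⟩
  choose R B hR hB hlt hΦ using step
  -- The state holds the current pure extension and the union of the blocks chosen so far.
  let S : ℕ → {r // PureLE r p} × Finset ℕ := fun n =>
    n.rec (⟨p, .refl p⟩, ∅) fun _ S => (R S, S.2 ∪ B S)
  let b : ℕ → Finset ℕ := fun n => B (S n)
  have hS2 : ∀ k, (S k).2 = (Finset.range k).biUnion b := by
    intro k
    induction k with
    | zero => rfl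
    | succ k ih =>
      rw [Finset.range_add_one, Finset.biUnion_insert, Finset.union_comm, ← ih]
  have hRS : ∀ j k, j ≤ k → PureLE (R (S k)).1 (R (S j)).1 := by
    intro j k hjk
    induction k, hjk using Nat.le_induction with
    | base => exact .refl _
    | succ k _ ih => exact (hR (S (k + 1))).trans ih
  have hsub : ∀ i j, i < j → b i ⊆ (S j).2 := by
    intro i j hij
    rw [hS2]
    exact Finset.subset_biUnion_of_mem b (Finset.mem_range.2 hij)
  have hblt : ∀ i j, i < j → BlockLT (b i) (b j) := fun i j hij =>
    (hlt (S j)).mono (hsub i j hij) subset_rfl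
  have hbne : ∀ i, (b i).Nonempty := fun i => (R (S i)).1.nonempty _ (hB (S i))
  have hbp : ∀ i, IsFiniteUnion p.blocks (b i) := fun i => (R (S i)).2.1.2.1 _ (hB (S i))
  refine ⟨ofSeq p.stem b hbne hblt fun i => blockLT_stem_of_isFiniteUnion (hbp i), b,
    pureLE_of_blocks rfl ?_, rfl, hblt, ?_⟩
  · rintro _ ⟨i, rfl⟩
    exact hbp i
  intro k t ht hf
  rw [← hS2] at ht ⊢
  -- Blocks chosen from stage `k` on are unions of blocks of the condition built at stage `k`, and
  -- only these survive the restriction.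
  refine hmono _ _ _ ?_ (restrict_pureLE_restrict ?_ ?_ t) (hΦ (S k) t ht hf)
  · exact ((R (S k)).2.restrict t _).1.trans (restrict_le hf _)
  · exact (R (S k)).2.2.symm
  · rintro _ ⟨j, rfl⟩ hj
    have hkj : k ≤ j := by
      by_contra! h
      obtain ⟨n, hn⟩ := hbne j
      exact lt_irrefl _ (hj n (hsub j k h hn) n hn)
    exact (hRS k j hkj).1.2.1 _ (hB (S j))

end MatetCond

open Function PName

namespace MatetCond

/-! ### Continuous reading of names -/

/-- Along every branch `y` of an extension of `q`, the real `x` is decided to be `F y`. -/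
def Reads (F : (ℕ → Bool) → ℕ → Bool) (x : PName.{u} MatetCond) (q : MatetCond) : Prop :=
  ∀ r ≤ q, ∀ y ∈ r.branches, ∀ n, ∃ r' ≤ r, y ∈ r'.branches ∧ Decides x n (F y n = true) r'

theorem mem_stem_of_le {r q : MatetCond} (h : r ≤ q) {e : Finset ℕ}
    (hq : ∀ a ∈ q.blocks, BlockLT e a) {n : ℕ} (hn : n ∈ e) (hr : n ∈ r.stem) : n ∈ q.stem := by
  by_contra hs
  obtain ⟨a, ha, hna, -⟩ := h.2.2.exists_mem (Finset.mem_sdiff.2 ⟨hr, hs⟩)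
  exact lt_irrefl _ (hq a ha n hn n hna)

theorem forcesMem_matetReal_iff {n : ℕ} {p : MatetCond} :
    ForcesMem (nat n) matetReal.{u} p ↔ ∀ q ≤ p, ∃ r ≤ q, n ∈ r.stem := by
  refine forall₂_congr fun q _ => ⟨?_, ?_⟩
  · rintro ⟨r, hr, ⟨⟨⟨m, c⟩, hm⟩⟩, hc, e⟩
    obtain rfl := nat_injective e
    exact ⟨r, hr, hc.1 hm⟩
  · rintro ⟨r, hr, hn⟩
    exact ⟨r, hr, ⟨⟨(n, r), hn⟩⟩, le_rfl, ForcesEq.refl _ _⟩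

theorem decides_matetReal {p : MatetCond} {e : Finset ℕ} (hp : ∀ a ∈ p.blocks, BlockLT e a)
    {n : ℕ} (hn : n ∈ e) : Decides matetReal.{u} n (n ∈ p.stem) p := by
  refine ⟨fun h => forcesMem_matetReal_iff.2 fun q hq => ⟨q, le_rfl, hq.1 h⟩, fun h q hq hm => ?_⟩
  obtain ⟨r, hr, hnr⟩ := forcesMem_matetReal_iff.1 hm q le_rfl
  exact h (mem_stem_of_le (hr.trans hq) hp hn hnr)

theorem reads_matetReal (q : MatetCond) : Reads id matetReal.{u} q := by
  intro r _ y hy n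
  obtain ⟨r', hr', hy', hb⟩ := exists_le_mem_branches hy {n}
  refine ⟨r', hr', hy', ?_⟩
  rw [id, ← mem_stem_iff_of_mem_branches hy' hb (Finset.mem_singleton_self n)]
  exact decides_matetReal hb (Finset.mem_singleton_self n)

theorem forcesReal_matetReal (p : MatetCond) : ForcesReal matetReal.{u} p :=
  forcesReal_of_elt_nat p

theorem forcesNew_matetReal (p : MatetCond) : ForcesNew matetReal.{u} p := by
  rintro ⟨α, A⟩ q - h
  obtain ⟨a, ha, -⟩ := q.exists_blockLT ∅
  obtain ⟨i, hi⟩ := q.nonempty a ha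
  have h₁ := restrict_le (.of_mem ha : IsFiniteUnion q.blocks a) ∅
  have h₂ := (q.restrict_empty_pureLE {i}).1
  rw [matetReal, check, ForcesEq] at h
  -- Putting `a` into the stem makes `i` an element of the ground model set; dropping all blocks
  -- that are not above `i` keeps `i` out of the generic real.
  obtain ⟨r, -, j, -, e⟩ := h.1 ⟨⟨(i, q.restrict a ∅), Finset.mem_union_right _ hi⟩⟩ _ h₁ le_rfl
  obtain ⟨r', hr', ⟨⟨⟨k, c⟩, hk⟩⟩, hc, e'⟩ := h.2 (j.1, q.restrict ∅ {i}) _ h₂ le_rfl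
  obtain rfl : i = k := ofNat_injective
    ((equiv_of_forcesEq_check e).trans (equiv_of_forcesEq_check e').symm)
  have hs : i ∈ (q.restrict ∅ {i}).stem := by
    refine mem_stem_of_le hr' (e := {i}) (fun b hb => ?_) (Finset.mem_singleton_self i) (hc.1 hk)
    exact hb.2.mono Finset.subset_union_right subset_rfl
  rw [restrict_stem, Finset.union_empty] at hs
  exact lt_irrefl _ (q.stem_lt a ha i hs i hi)

theorem exists_forall_eq_of_continuousOn {h : (ℕ → Bool) → ℕ → Bool} {S : Set (ℕ → Bool)}
    (hh : ContinuousOn h S) {z : ℕ → Bool} (hz : z ∈ S) (n : ℕ) :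
    ∃ m, ∀ w ∈ S, (∀ i < m, w i = z i) → h w n = h z n := by
  have hc : ContinuousWithinAt (fun w => h w n) S z :=
    (continuous_apply n).continuousAt.comp_continuousWithinAt (hh z hz)
  have hm := hc (show {h z n} ∈ nhds (h z n) from (isOpen_discrete _).mem_nhds rfl)
  obtain ⟨U, hU, hzU, hsub⟩ := mem_nhdsWithin.1 hm
  obtain ⟨_, ⟨w, m, rfl⟩, hzw, hw⟩ :=
    (PiNat.isTopologicalBasis_cylinders fun _ : ℕ => Bool).exists_subset_of_mem_open hzU hU
  refine ⟨m, fun w' hw' he => hsub ⟨hw ?_, hw'⟩⟩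
  rw [PiNat.mem_cylinder_iff] at hzw ⊢
  exact fun i hi => (he i hi).trans (hzw i hi)

theorem Reads.exists_forcesInitial {F : (ℕ → Bool) → ℕ → Bool} {x : PName.{u} MatetCond}
    {q r : MatetCond} (hF : Reads F x q) (hr : r ≤ q) {y : ℕ → Bool} (hy : y ∈ r.branches)
    (m : ℕ) : ∃ r' ≤ r, ForcesInitial ((List.range m).map (F y)) x r' := by
  have : ∃ r' ≤ r, y ∈ r'.branches ∧ ∀ i < m, Decides x i (F y i = true) r' := by
    induction m with
    | zero => exact ⟨r, le_rfl, hy, by simp⟩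
    | succ m ih =>
      obtain ⟨r₁, h₁, hy₁, hd₁⟩ := ih
      obtain ⟨r₂, h₂, hy₂, hd₂⟩ := hF r₁ (h₁.trans hr) y hy₁ m
      refine ⟨r₂, h₂.trans h₁, hy₂, fun i hi => ?_⟩
      rcases Nat.lt_succ_iff_lt_or_eq.1 hi with hi | rfl
      · exact (hd₁ i hi).mono h₂
      · exact hd₂
  obtain ⟨r', hr', -, hd⟩ := this
  refine ⟨r', hr', fun i => ?_⟩
  by_cases hi : i < m
  · simp only [List.getElem?_map, List.getElem?_range hi, Option.map_some, Option.some.injEq]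
    exact ⟨(hd i hi).1, fun h => (hd i hi).2 (by simp [h])⟩
  · simp [not_lt.1 hi]

/-- If `x` and `z` are read continuously along branches, then `z` is forced to be the image of `x`
under every continuous function that is compatible with the readings. -/
theorem forcesEq_image {F F' h : (ℕ → Bool) → ℕ → Bool} {x z : PName.{u} MatetCond}
    {q : MatetCond} (hx : Reads F x q) (hz : Reads F' z q) (hzr : ForcesReal z q)
    (hc : ContinuousOn h (F '' q.branches)) (hF : ∀ y ∈ q.branches, h (F y) = F' y) :
    ForcesEq (image (F '' q.branches) h x) z q := by
  refine forcesEq_of_forall_nat (forcesReal_image _ _ _ _) hzr fun n r hr => ?_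
  rw [forcesMem_image_iff]
  constructor
  · refine fun H => forcesMem_of_dense fun q' hq' => ?_
    obtain ⟨r', hr', σ, hσ, hh⟩ := H q' hq'
    -- Any branch `y` of `r'` serves: `r'` forces `σ`, and the digits of `x` can be decided along
    -- `y` to be those of `F y`, so `F y` extends `σ`.
    obtain ⟨y, hy⟩ := r'.branches_nonempty
    have hr'q := hr'.trans (hq'.trans hr)
    have hyq := branches_mono hr'q hy
    have hn : F' y n = true := by
      rw [← hF y hyq]
      refine hh _ ⟨y, hyq, rfl⟩ fun i b hi => ?_
      obtain ⟨r'', hr'', -, hd⟩ := hx r' hr'q y hy i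
      cases b with
      | true =>
        by_contra hne
        exact hd.2 hne r'' le_rfl (((hσ i).1 hi).mono hr'')
      | false =>
        by_contra hne
        exact (hσ i).2 hi r'' hr'' (hd.1 (by simpa using hne))
    obtain ⟨r'', hr'', -, hd⟩ := hz r' hr'q y hy n
    exact ⟨r'', hr''.trans hr', hd.1 hn⟩
  · intro H q' hq'
    obtain ⟨y, hy⟩ := q'.branches_nonempty
    have hyq := branches_mono (hq'.trans hr) hy
    have hn : F' y n = true := by
      by_contra hne
      obtain ⟨r', hr', -, hd⟩ := hz q' (hq'.trans hr) y hy n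
      exact hd.2 hne r' le_rfl (H.mono (hr'.trans hq'))
    -- Continuity at `F y` turns the value at `n` into a property of a finite initial segment, which
    -- an extension along `y` forces.
    obtain ⟨m, hm⟩ := exists_forall_eq_of_continuousOn hc ⟨y, hyq, rfl⟩ n
    obtain ⟨r', hr', hσ⟩ := hx.exists_forcesInitial (hq'.trans hr) hy m
    refine ⟨r', hr', _, hσ, fun w hw hwσ => ?_⟩
    rw [hm w hw fun i hi => hwσ i _ (by simp [List.getElem?_range hi]), hF y hyq, hn]

/-! ### Pure decision -/

theorem decides_restrict_of_le {x : PName.{u} MatetCond} {n : ℕ} {b : Prop} {r q : MatetCond}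
    {e : Finset ℕ} (h : r ≤ q) (hd : Decides x n b (q.restrict (r.stem \ q.stem) e)) :
    Decides x n b (r.restrict ∅ e) :=
  hd.mono (restrict_le_restrict_sdiff h e)

/-- If `q` extended by any nonempty finite union `u` of blocks of `q'` decides `n ∈ x` in the same
way, once finitely many blocks are dropped, then the pure extension `q'` of `q` decides it. -/
theorem decides_of_forall_restrict {x : PName.{u} MatetCond} {n : ℕ} {b : Prop}
    {q q' : MatetCond} (h : PureLE q' q) (hd : ∀ u, u.Nonempty → IsFiniteUnion q'.blocks u →
      ∃ e, Decides x n b (q.restrict u e)) : Decides x n b q' := by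
  refine decides_of_dense fun r hr => ?_
  obtain ⟨r', hr', hne⟩ := exists_le_sdiff_nonempty hr
  obtain ⟨e, he⟩ := hd _ hne (hr'.trans hr).2.2
  rw [h.2] at he
  exact ⟨r'.restrict ∅ e, (r'.restrict_empty_pureLE e).1.trans hr',
    decides_restrict_of_le (hr'.trans (hr.trans h.1)) he⟩

theorem exists_subset_biUnion {b : ℕ → Finset ℕ} {u : Finset ℕ}
    (hu : IsFiniteUnion (Set.range b) u) (m : ℕ) : ∃ k, m ≤ k ∧ u ⊆ (Finset.range k).biUnion b := by
  obtain ⟨F, hF, rfl⟩ := hu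
  obtain ⟨I, -, rfl⟩ := Finset.subset_set_image_iff.1 (Set.image_univ ▸ hF)
  refine ⟨max m (I.sup id + 1), le_max_left _ _, ?_⟩
  rw [Finset.image_biUnion]
  refine Finset.biUnion_subset_biUnion_of_subset_left b fun i hi => Finset.mem_range.2 ?_
  exact lt_max_of_lt_right (Nat.lt_succ_of_le (Finset.le_sup (f := id) hi))

theorem exists_pureLE_decides (x : PName.{u} MatetCond) (n : ℕ) (p : MatetCond) :
    ∃ q, PureLE q p ∧ ∃ b, Decides x n b q := by
  obtain ⟨q, b, hq, hb, -, hΦ⟩ := fusion (p := p)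
    -- Either `r` decides the digit or no pure extension of it does.
    (Φ := fun _ r => (∀ r', PureLE r' r → ¬ ∃ b, Decides x n b r') ∨ ∃ b, Decides x n b r)
    (by
      rintro e r r' - hr (h | ⟨b, h⟩)
      · exact Or.inl fun r'' hr'' => h r'' (hr''.trans hr)
      · exact Or.inr ⟨b, h.mono hr.1⟩)
    (by
      intro e r _
      by_cases h : ∃ r', PureLE r' r ∧ ∃ b, Decides x n b r'
      · obtain ⟨r', hr', hd⟩ := h
        exact ⟨r', hr', Or.inr hd⟩
      · exact ⟨r, .refl r, Or.inl fun r' hr' hd => h ⟨r', hr', hd⟩⟩)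
  obtain ⟨q₁, h₁, hh⟩ := q.exists_homogeneous fun u => ∃ e, Decides x n True (q.restrict u e)
  rcases hh with hh | hh₁
  · exact ⟨q₁, h₁.trans hq, True, decides_of_forall_restrict h₁ hh⟩
  obtain ⟨q₂, h₂, hh⟩ := q₁.exists_homogeneous fun u => ∃ e, Decides x n False (q.restrict u e)
  have h₂₁ := h₂.trans h₁
  rcases hh with hh | hh₂
  · exact ⟨q₂, h₂₁.trans hq, False, decides_of_forall_restrict h₂₁ hh⟩
  -- Some extension of `q₂` decides the digit. It yields a pure extension of `q` restricted to its
  -- stem, so by the dichotomy that restriction decides too, contrary to both homogeneous negative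
  -- answers.
  exfalso
  obtain ⟨r, hr, c, hc⟩ := exists_decides x n q₂
  obtain ⟨r', hr', hne⟩ := exists_le_sdiff_nonempty hr
  have hu₂ := (hr'.trans hr).2.2
  have hu₁ := hu₂.trans h₂.1.2.1
  have hu := hu₁.trans h₁.1.2.1
  obtain ⟨k, -, hk⟩ := exists_subset_biUnion (hb ▸ hu) 0
  have hrq : r' ≤ q := hr'.trans (hr.trans h₂₁.1)
  rcases hΦ k _ hk (hu.trans hq.1.2.1) with h | ⟨c', hc'⟩
  · refine h (r'.restrict ∅ ((Finset.range k).biUnion b)) ⟨?_, ?_⟩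
      ⟨c, hc.mono ((r'.restrict_empty_pureLE _).1.trans hr')⟩
    · rw [h₂₁.2]
      exact restrict_le_restrict_sdiff hrq _
    · rw [h₂₁.2, restrict_stem, restrict_stem, stem_union_sdiff hrq, Finset.union_empty]
  · by_cases hc'' : c'
    · exact hh₁ _ hne hu₁ ⟨_, by simpa only [hc''] using hc'⟩
    · exact hh₂ _ hne hu₂ ⟨_, by simpa only [hc''] using hc'⟩

theorem exists_pureLE_forall_lt_decides (x : PName.{u} MatetCond) (m : ℕ) (p : MatetCond) :
    ∃ q, PureLE q p ∧ ∀ n < m, ∃ b, Decides x n b q := by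
  induction m with
  | zero => exact ⟨p, .refl p, by simp⟩
  | succ m ih =>
    obtain ⟨q, hq, hd⟩ := ih
    obtain ⟨q', hq', b, hb⟩ := exists_pureLE_decides x m q
    refine ⟨q', hq'.trans hq, fun n hn => ?_⟩
    rcases Nat.lt_succ_iff_lt_or_eq.1 hn with hn | rfl
    · obtain ⟨b, hb⟩ := hd n hn
      exact ⟨b, hb.mono hq'.1⟩
    · exact ⟨b, hb⟩

/-! ### Guesses for the new real -/

/-- The property in a fusion sees the finite set `e` but not the stage, so `e.card` serves as the
number of digits to decide; this bound shows that it is at least the stage. -/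
theorem le_card_biUnion {b : ℕ → Finset ℕ} (hne : ∀ i, (b i).Nonempty)
    (hlt : ∀ i j, i < j → BlockLT (b i) (b j)) (k : ℕ) : k ≤ ((Finset.range k).biUnion b).card := by
  refine StrictMono.le_apply (f := fun k => ((Finset.range k).biUnion b).card)
    (strictMono_nat_of_lt_succ fun k => Finset.card_lt_card ?_)
  rw [Finset.range_add_one, Finset.biUnion_insert, Finset.ssubset_iff_of_subset
    Finset.subset_union_right]
  obtain ⟨n, hn⟩ := hne k
  refine ⟨n, Finset.mem_union_left _ hn, fun h => ?_⟩
  obtain ⟨i, hi, hni⟩ := Finset.mem_biUnion.1 h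
  exact lt_irrefl _ (hlt i k (Finset.mem_range.1 hi) n hni n hn)

/-- After a pure extension, every finite stem `t` has a guess `X t` of the real `x`, each digit
of which is forced once finitely many blocks are dropped. -/
theorem exists_guess (x : PName.{u} MatetCond) (p : MatetCond) :
    ∃ q, PureLE q p ∧ ∃ X : Finset ℕ → ℕ → Prop, ∀ t, IsFiniteUnion q.blocks t → ∀ n,
      ∃ e, Decides x n (X t n) (q.restrict t e) := by
  obtain ⟨q, b, hq, hb, hlt, hΦ⟩ := fusion (p := p)
    (Φ := fun e r => ∀ n < e.card, ∃ b, Decides x n b r)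
    (fun e r r' _ hr h n hn => (h n hn).imp fun b hb => hb.mono hr.1)
    (fun e r _ => exists_pureLE_forall_lt_decides x e.card r)
  have hne : ∀ i, (b i).Nonempty := fun i => q.nonempty _ (hb ▸ ⟨i, rfl⟩)
  have key : ∀ t, ∀ n, ∃ c : Prop, IsFiniteUnion q.blocks t →
      ∃ e, Decides x n c (q.restrict t e) := by
    intro t n
    by_cases ht : IsFiniteUnion q.blocks t
    · obtain ⟨k, hk, htk⟩ := exists_subset_biUnion (hb ▸ ht) (n + 1)
      obtain ⟨c, hc⟩ := hΦ k t htk (ht.trans hq.1.2.1) n (hk.trans (le_card_biUnion hne hlt k))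
      exact ⟨c, fun _ => ⟨_, hc⟩⟩
    · exact ⟨True, fun h => absurd h ht⟩
  choose X hX using key
  exact ⟨q, hq, X, fun t ht n => hX t n ht⟩

/-- Only finitely many pairs of subsets of `e` have to be separated. The bound by `e.card` makes `N`
grow along a fusion. -/
theorem exists_bound (X : Finset ℕ → ℕ → Prop) (e : Finset ℕ) :
    ∃ N, e.card ≤ N ∧ ∀ t ⊆ e, ∀ t' ⊆ e, X t ≠ X t' → ∃ n < N, ¬ (X t n ↔ X t' n) := by
  classical
  have : ∀ t t', ∃ n, X t ≠ X t' → ¬ (X t n ↔ X t' n) := by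
    intro t t'
    by_cases h : X t = X t'
    · exact ⟨0, fun h' => absurd h h'⟩
    · by_contra! hn
      exact h (funext fun n => propext (hn n).2)
  choose δ hδ using this
  refine ⟨max e.card ((e.powerset ×ˢ e.powerset).sup fun z => δ z.1 z.2 + 1), le_max_left _ _,
    fun t ht t' ht' h => ⟨δ t t', lt_max_of_lt_right ?_, hδ t t' h⟩⟩
  exact Finset.le_sup (f := fun z : Finset ℕ × Finset ℕ => δ z.1 z.2 + 1) (b := (t, t'))
    (Finset.mem_product.2 ⟨Finset.mem_powerset.2 ht, Finset.mem_powerset.2 ht'⟩)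

theorem exists_forall_lt_decides_restrict {x : PName.{u} MatetCond} {q r : MatetCond}
    {X : Finset ℕ → ℕ → Prop} (hX : ∀ t, IsFiniteUnion q.blocks t → ∀ n,
      ∃ e, Decides x n (X t n) (q.restrict t e)) (hr : r ≤ q) (m : ℕ) :
    ∃ e, ∀ n < m, Decides x n (X (r.stem \ q.stem) n) (r.restrict ∅ e) := by
  choose e he using hX _ hr.2.2
  exact ⟨(Finset.range m).biUnion e, fun n hn => (decides_restrict_of_le hr (he n)).mono
    (r.restrict_anti ∅ (Finset.subset_biUnion_of_mem e (Finset.mem_range.2 hn)))⟩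

/-- Since `x` is new, the guesses change whenever the stem grows, after a pure extension. -/
theorem exists_pureLE_guess_ne {x : PName.{u} MatetCond} {q r : MatetCond}
    {X : Finset ℕ → ℕ → Prop} (hxr : ForcesReal x q) (hxn : ForcesNew x q)
    (hX : ∀ t, IsFiniteUnion q.blocks t → ∀ n, ∃ e, Decides x n (X t n) (q.restrict t e))
    (hr : r ≤ q) : ∃ r', PureLE r' r ∧ ∀ u, u.Nonempty → IsFiniteUnion r'.blocks u →
      X (r.stem \ q.stem ∪ u) ≠ X (r.stem \ q.stem) := by
  obtain ⟨r', hr', h | h⟩ := r.exists_homogeneous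
    fun u => X (r.stem \ q.stem ∪ u) = X (r.stem \ q.stem)
  · have hr'q := hr'.1.trans hr
    -- If adding blocks never changed the guess, `r'` would decide every digit of `x` as the guess
    -- at its own stem does.
    refine absurd (fun n => ?_) (ForcesNew.not_forall_decides (hxr.mono hr'q)
      (fun y s hs => hxn y s (hs.trans hr'q)) (X (r.stem \ q.stem)))
    refine decides_of_dense fun s hs => ?_
    obtain ⟨s', hs', hne⟩ := exists_le_sdiff_nonempty hs
    have hs'r := hs'.trans hs
    have hs'q := hs'r.trans hr'q
    have heq : r.stem \ q.stem ∪ s'.stem \ r'.stem = s'.stem \ q.stem := by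
      rw [hr'.2]
      ext i
      have h₁ := @hr.1 i
      have h₂ := @(hs'r.trans hr'.1).1 i
      simp only [Finset.mem_union, Finset.mem_sdiff]
      tauto
    obtain ⟨e, he⟩ := hX _ hs'q.2.2 n
    rw [← heq, h _ hne hs'r.2.2, heq] at he
    exact ⟨s'.restrict ∅ e, (s'.restrict_empty_pureLE e).1.trans hs',
      decides_restrict_of_le hs'q he⟩
  · exact ⟨r', hr', h⟩

/-! ### The continuous injective coding -/

/-- The union of the blocks `b i`, for `i < k` in the set coded by `d`. -/
def initialUnion (b : ℕ → Finset ℕ) (d : ℕ → Bool) (k : ℕ) : Finset ℕ :=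
  ((Finset.range k).filter fun i => d i = true).biUnion b

theorem mem_initialUnion {b : ℕ → Finset ℕ} {d : ℕ → Bool} {k n : ℕ} :
    n ∈ initialUnion b d k ↔ ∃ i < k, d i = true ∧ n ∈ b i := by
  simp [initialUnion, and_assoc]

theorem initialUnion_subset (b : ℕ → Finset ℕ) (d : ℕ → Bool) (k : ℕ) :
    initialUnion b d k ⊆ (Finset.range k).biUnion b :=
  Finset.biUnion_subset_biUnion_of_subset_left b (Finset.filter_subset _ _)

theorem isFiniteUnion_initialUnion (b : ℕ → Finset ℕ) (d : ℕ → Bool) (k : ℕ) :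
    IsFiniteUnion (Set.range b) (initialUnion b d k) := by
  refine .of_forall fun n hn => ?_
  obtain ⟨i, hi, hd, hni⟩ := mem_initialUnion.1 hn
  exact ⟨b i, ⟨i, rfl⟩, hni, fun m hm => mem_initialUnion.2 ⟨i, hi, hd, hm⟩⟩

theorem initialUnion_congr {b : ℕ → Finset ℕ} {d d' : ℕ → Bool} {k : ℕ}
    (h : ∀ i < k, d i = d' i) : initialUnion b d k = initialUnion b d' k := by
  ext n
  rw [mem_initialUnion, mem_initialUnion]
  exact exists_congr fun i => and_congr_right fun hi => by rw [h i hi]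

theorem initialUnion_succ {b : ℕ → Finset ℕ} {d : ℕ → Bool} {k : ℕ} :
    initialUnion b d (k + 1) = if d k = true then initialUnion b d k ∪ b k
      else initialUnion b d k := by
  rw [initialUnion, Finset.range_add_one, Finset.filter_insert]
  split
  · rw [Finset.biUnion_insert, Finset.union_comm]
    rfl
  · rfl

theorem eq_of_mem_seq {b : ℕ → Finset ℕ} (hlt : ∀ i j, i < j → BlockLT (b i) (b j)) {i j n : ℕ}
    (hi : n ∈ b i) (hj : n ∈ b j) : i = j := by
  rcases lt_trichotomy i j with h | h | h
  · exact absurd (hlt i j h n hi n hj) (lt_irrefl n)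
  · exact h
  · exact absurd (hlt j i h n hj n hi) (lt_irrefl n)

theorem initialUnion_inter {b : ℕ → Finset ℕ} (hlt : ∀ i j, i < j → BlockLT (b i) (b j))
    (d : ℕ → Bool) {k j : ℕ} (hkj : k ≤ j) :
    initialUnion b d j ∩ (Finset.range k).biUnion b = initialUnion b d k := by
  ext n
  simp only [Finset.mem_inter, mem_initialUnion, Finset.mem_biUnion, Finset.mem_range]
  constructor
  · rintro ⟨⟨i, -, hd, hni⟩, i', hi', hni'⟩
    obtain rfl := eq_of_mem_seq hlt hni hni'
    exact ⟨i, hi', hd, hni⟩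
  · rintro ⟨i, hi, hd, hni⟩
    exact ⟨⟨i, hi.trans_le hkj, hd, hni⟩, i, hi, hni⟩

theorem subset_or_blockLT_biUnion {b : ℕ → Finset ℕ} (hlt : ∀ i j, i < j → BlockLT (b i) (b j))
    (k : ℕ) : ∀ a ∈ Set.range b,
      a ⊆ (Finset.range k).biUnion b ∨ BlockLT ((Finset.range k).biUnion b) a := by
  rintro _ ⟨i, rfl⟩
  rcases lt_or_ge i k with hi | hi
  · exact Or.inl (Finset.subset_biUnion_of_mem b (Finset.mem_range.2 hi))
  · refine Or.inr fun m hm n hn => ?_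
    obtain ⟨j, hj, hmj⟩ := Finset.mem_biUnion.1 hm
    exact hlt j i ((Finset.mem_range.1 hj).trans_le hi) m hmj n hn

/-- After a pure extension with blocks `b 0 < b 1 < ⋯`, a new real is the value of a continuous
injective function of the set of indices of the blocks that are used. -/
theorem exists_coding {x : PName.{u} MatetCond} {p : MatetCond} (hxr : ForcesReal x p)
    (hxn : ForcesNew x p) : ∃ (q : MatetCond) (b : ℕ → Finset ℕ) (F : (ℕ → Bool) → ℕ → Bool),
      PureLE q p ∧ q.blocks = Set.range b ∧ (∀ i j, i < j → BlockLT (b i) (b j)) ∧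
      Continuous F ∧ Injective F ∧ ∀ d n, Decides x n (F d n = true)
        (q.restrict (initialUnion b d (n + 1)) ((Finset.range (n + 1)).biUnion b)) := by
  classical
  obtain ⟨p₁, hp₁, X, hX⟩ := exists_guess x p
  have hxr₁ := hxr.mono hp₁.1
  have hxn₁ : ForcesNew x p₁ := fun y s hs => hxn y s (hs.trans hp₁.1)
  choose N hN hNX using exists_bound X
  obtain ⟨q, b, hq, hb, hlt, hΦ⟩ := fusion (p := p₁)
    -- Longer stems have a different guess, and the guess at the present stem is already forced on
    -- as many digits as separate the guesses of subsets of `e`.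
    (Φ := fun e r => (∀ u, u.Nonempty → IsFiniteUnion r.blocks u →
        X (r.stem \ p₁.stem ∪ u) ≠ X (r.stem \ p₁.stem)) ∧
      ∀ n < N e, Decides x n (X (r.stem \ p₁.stem) n) r)
    (by
      rintro e r r' - hr ⟨h, h'⟩
      rw [hr.2]
      exact ⟨fun u hu hf => h u hu (hf.trans hr.1.2.1), fun n hn => (h' n hn).mono hr.1⟩)
    (by
      intro e r hr
      obtain ⟨r₁, h₁, hne⟩ := exists_pureLE_guess_ne hxr₁ hxn₁ hX hr
      obtain ⟨e', he'⟩ := exists_forall_lt_decides_restrict hX (h₁.1.trans hr) (N e)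
      have h₂ := r₁.restrict_empty_pureLE e'
      refine ⟨_, h₂.trans h₁, ?_, ?_⟩
      · rw [h₂.2, h₁.2]
        exact fun u hu hf => hne u hu (hf.trans h₂.1.2.1)
      · rwa [h₂.2])
  have hne : ∀ i, (b i).Nonempty := fun i => q.nonempty _ (hb ▸ ⟨i, rfl⟩)
  set e : ℕ → Finset ℕ := fun k => (Finset.range k).biUnion b
  have hNk : ∀ k, k ≤ N (e k) := fun k => (le_card_biUnion hne hlt k).trans (hN _)
  have hfu : ∀ d k, IsFiniteUnion q.blocks (initialUnion b d k) := fun d k =>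
    hb ▸ isFiniteUnion_initialUnion b d k
  have hfu₁ : ∀ d k, IsFiniteUnion p₁.blocks (initialUnion b d k) := fun d k =>
    (hfu d k).trans hq.1.2.1
  have hΦ' : ∀ d k, (∀ u, u.Nonempty →
      IsFiniteUnion (q.restrict (initialUnion b d k) (e k)).blocks u →
        X (initialUnion b d k ∪ u) ≠ X (initialUnion b d k)) ∧ ∀ n < N (e k),
      Decides x n (X (initialUnion b d k) n) (q.restrict (initialUnion b d k) (e k)) := by
    intro d k
    have h := hΦ k _ (initialUnion_subset b d k) (hfu₁ d k)
    rwa [restrict_stem, hq.2, union_sdiff_stem (hfu₁ d k)] at h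
  have hstab : ∀ d k j n, k ≤ j → n < N (e k) →
      (X (initialUnion b d j) n ↔ X (initialUnion b d k) n) := by
    intro d k j n hkj hn
    obtain ⟨e', he'⟩ := hX _ (hfu₁ d j) n
    have hej : e k ⊆ e j := Finset.biUnion_subset_biUnion_of_subset_left b
      (Finset.range_subset_range.2 hkj)
    -- The two decisions have a common extension, so the digits below `N (e k)` are never revised
    -- after stage `k`.
    refine he'.iff_of_le ((hΦ' d k).2 n hn)
      (r := q.restrict (initialUnion b d j) (e j ∪ e')) ?_ ?_
    · exact (q.restrict_anti _ Finset.subset_union_right).trans (hq.restrict _ e').1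
    · have h := le_restrict_inter (restrict_le (hfu d j) (e j ∪ e')) (e := e k)
        (fun a ha => subset_or_blockLT_biUnion hlt k a (hb ▸ ha))
        fun a ha => ha.2.mono ((hej.trans Finset.subset_union_left).trans
          Finset.subset_union_right) subset_rfl
      rwa [restrict_stem, union_sdiff_stem (hfu d j), initialUnion_inter hlt d hkj] at h
  -- Digit `n` is final at stage `n + 1`, since `n < n + 1 ≤ N (e (n + 1))`.
  let F : (ℕ → Bool) → ℕ → Bool := fun d n => decide (X (initialUnion b d (n + 1)) n)
  have hF : ∀ d n, F d n = true ↔ X (initialUnion b d (n + 1)) n := fun d n => decide_eq_true_iff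
  have hFk : ∀ d k n, n < N (e k) → (F d n = true ↔ X (initialUnion b d k) n) := by
    intro d k n hn
    rw [hF]
    rcases le_total k (n + 1) with h | h
    · exact hstab d k (n + 1) n h hn
    · exact (hstab d (n + 1) k n h (hNk (n + 1))).symm
  have hFne : ∀ d d' k, (∀ i < k, d i = d' i) → d k = true → d' k = false → F d ≠ F d' := by
    intro d d' k hdd hd hd' hFF
    have h₁ : initialUnion b d (k + 1) = initialUnion b d k ∪ b k := by
      rw [initialUnion_succ, if_pos hd]
    have h₂ : initialUnion b d' (k + 1) = initialUnion b d k := by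
      rw [initialUnion_succ, if_neg (by simp [hd']), initialUnion_congr hdd]
    have hbk : b k ∈ (q.restrict (initialUnion b d k) (e k)).blocks := by
      refine ⟨hb ▸ ⟨k, rfl⟩, ?_⟩
      rw [Finset.union_eq_right.2 (initialUnion_subset b d k)]
      intro m hm n hn
      obtain ⟨j, hj, hmj⟩ := Finset.mem_biUnion.1 hm
      exact hlt j k (Finset.mem_range.1 hj) m hmj n hn
    have hX' := (hΦ' d k).1 (b k) (hne k) (.of_mem hbk)
    rw [← h₁, ← h₂] at hX'
    -- Both stems are subsets of `e (k + 1)`, so their guesses differ at a digit already settled at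
    -- stage `k + 1`.
    obtain ⟨n, hn, hnX⟩ := hNX (e (k + 1)) _ (initialUnion_subset b d (k + 1)) _
      (initialUnion_subset b d' (k + 1)) hX'
    rw [← hFk d _ n hn, ← hFk d' _ n hn, hFF] at hnX
    exact hnX Iff.rfl
  refine ⟨q, b, F, hq.trans hp₁, hb, hlt, ?_, ?_, fun d n => ?_⟩
  · refine continuous_pi fun n => continuous_discrete_rng.2 fun c => ?_
    rw [isOpen_iff_mem_nhds]
    intro d hd
    refine Filter.mem_of_superset ((PiNat.isOpen_cylinder _ d (n + 1)).mem_nhds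
      (PiNat.self_mem_cylinder d (n + 1))) fun d' hd' => ?_
    rw [PiNat.mem_cylinder_iff] at hd'
    simp only [Set.mem_preimage, Set.mem_singleton_iff, F] at hd ⊢
    rwa [initialUnion_congr hd']
  · intro d d' hFF
    by_contra hdd
    have hex : ∃ k, d k ≠ d' k := by
      by_contra! h
      exact hdd (funext h)
    have hmin : ∀ i < Nat.find hex, d i = d' i := fun i hi => not_not.1 (Nat.find_min hex hi)
    have hk := Nat.find_spec hex
    cases h : d (Nat.find hex) <;> cases h' : d' (Nat.find hex)
    · exact hk (h.trans h'.symm)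
    · exact hFne d' d _ (fun i hi => (hmin i hi).symm) h' h hFF.symm
    · exact hFne d d' _ hmin h h' hFF
    · exact hk (h.trans h'.symm)
  · rw [hF]
    exact (hΦ' d (n + 1)).2 n (hNk (n + 1))

/-! ### The set coded by a set of indices -/

open Classical in
/-- The set `s ∪ ⋃ {b i : d i = 1}`. -/
noncomputable def unionOf (s : Finset ℕ) (b : ℕ → Finset ℕ) (d : ℕ → Bool) (n : ℕ) : Bool :=
  decide (n ∈ s ∨ ∃ i, d i = true ∧ n ∈ b i)

theorem unionOf_eq_true {s : Finset ℕ} {b : ℕ → Finset ℕ} {d : ℕ → Bool} {n : ℕ} :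
    unionOf s b d n = true ↔ n ∈ s ∨ ∃ i, d i = true ∧ n ∈ b i := by
  simp [unionOf]

theorem unionOf_of_mem {s : Finset ℕ} {b : ℕ → Finset ℕ}
    (hlt : ∀ i j, i < j → BlockLT (b i) (b j)) (hs : ∀ i, BlockLT s (b i)) (d : ℕ → Bool) {i n : ℕ}
    (hn : n ∈ b i) : unionOf s b d n = d i := by
  rw [Bool.eq_iff_iff, unionOf_eq_true]
  constructor
  · rintro (h | ⟨j, hd, hj⟩)
    · exact absurd (hs i n h n hn) (lt_irrefl n)
    · rwa [eq_of_mem_seq hlt hn hj]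
  · exact fun h => Or.inr ⟨i, h, hn⟩

theorem continuous_unionOf {s : Finset ℕ} {b : ℕ → Finset ℕ}
    (hlt : ∀ i j, i < j → BlockLT (b i) (b j)) (hs : ∀ i, BlockLT s (b i)) :
    Continuous (unionOf s b) := by
  refine continuous_pi fun n => ?_
  by_cases h : ∃ i, n ∈ b i
  · obtain ⟨i, hi⟩ := h
    simpa only [unionOf_of_mem hlt hs _ hi] using continuous_apply i
  · push Not at h
    have hc : ∀ d, unionOf s b d n = unionOf s b (fun _ => false) n := fun d => by
      rw [Bool.eq_iff_iff, unionOf_eq_true, unionOf_eq_true]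
      simp [h]
    simpa only [hc] using continuous_const

theorem injective_unionOf {s : Finset ℕ} {b : ℕ → Finset ℕ} (hne : ∀ i, (b i).Nonempty)
    (hlt : ∀ i j, i < j → BlockLT (b i) (b j)) (hs : ∀ i, BlockLT s (b i)) :
    Injective (unionOf s b) := by
  intro d d' h
  funext i
  obtain ⟨n, hn⟩ := hne i
  rw [← unionOf_of_mem hlt hs d hn, h, unionOf_of_mem hlt hs d' hn]

theorem branches_subset_range_unionOf {q : MatetCond} {b : ℕ → Finset ℕ}
    (hb : q.blocks = Set.range b) : q.branches ⊆ Set.range (unionOf q.stem b) := by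
  classical
  rintro y ⟨D, hD, -, hy⟩
  refine ⟨fun i => decide (b i ∈ D), funext fun n => ?_⟩
  rw [Bool.eq_iff_iff, unionOf_eq_true, hy]
  refine or_congr_right ⟨?_, ?_⟩
  · rintro ⟨i, hi, hn⟩
    exact ⟨b i, of_decide_eq_true hi, hn⟩
  · rintro ⟨a, ha, hn⟩
    obtain ⟨i, rfl⟩ : a ∈ Set.range b := hb ▸ hD ha
    exact ⟨i, decide_eq_true ha, hn⟩

/-- By compactness, a continuous injection of `2^ω` is a closed embedding. -/
theorem continuousOn_invFun_range {F : (ℕ → Bool) → ℕ → Bool} (hc : Continuous F)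
    (hi : Injective F) : ContinuousOn (invFun F) (Set.range F) := by
  rw [(hc.isClosedEmbedding hi).isInducing.continuousOn_iff]
  exact continuousOn_id.congr fun y hy => invFun_eq hy

/-- Once an extension along the branch coded by `d` has all its blocks above `b 0, …, b n`, its stem
contains exactly those of these blocks that `d` selects, so it lies below the condition that decides
digit `n`. -/
theorem reads_of_coding {x : PName.{u} MatetCond} {q : MatetCond} {b : ℕ → Finset ℕ}
    {F : (ℕ → Bool) → ℕ → Bool} (hb : q.blocks = Set.range b)
    (hlt : ∀ i j, i < j → BlockLT (b i) (b j)) (hF : ∀ d n, Decides x n (F d n = true)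
      (q.restrict (initialUnion b d (n + 1)) ((Finset.range (n + 1)).biUnion b))) :
    Reads (fun y => F (invFun (unionOf q.stem b) y)) x q := by
  have hmem : ∀ i, b i ∈ q.blocks := fun i => hb ▸ ⟨i, rfl⟩
  have hs : ∀ i, BlockLT q.stem (b i) := fun i => q.stem_lt _ (hmem i)
  intro r hr y hy n
  obtain ⟨d, rfl⟩ := branches_subset_range_unionOf hb (branches_mono hr hy)
  dsimp only
  rw [leftInverse_invFun (injective_unionOf (fun i => q.nonempty _ (hmem i)) hlt hs)]
  obtain ⟨r', hr', hy', ha⟩ := exists_le_mem_branches hy ((Finset.range (n + 1)).biUnion b)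
  refine ⟨r', hr', hy', (hF d n).mono ?_⟩
  have h := le_restrict_inter (hr'.trans hr)
    (fun a ha => subset_or_blockLT_biUnion hlt (n + 1) a (hb ▸ ha)) ha
  convert h using 2
  ext m
  rw [Finset.mem_inter, Finset.mem_sdiff, mem_initialUnion]
  constructor
  · rintro ⟨i, hi, hd, hm⟩
    have hme := Finset.mem_biUnion.2 ⟨i, Finset.mem_range.2 hi, hm⟩
    refine ⟨⟨?_, fun h => lt_irrefl _ (hs i m h m hm)⟩, hme⟩
    rw [mem_stem_iff_of_mem_branches hy' ha hme, unionOf_of_mem hlt hs d hm, hd]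
  · rintro ⟨⟨hm, -⟩, hme⟩
    rw [mem_stem_iff_of_mem_branches hy' ha hme] at hm
    obtain ⟨i, hi, hmi⟩ := Finset.mem_biUnion.1 hme
    exact ⟨i, Finset.mem_range.1 hi, (unionOf_of_mem hlt hs d hmi).symm.trans hm, hmi⟩

end MatetCond

/-! ### The theorem -/

theorem mainTheorem8 :
    (∀ p : MatetCond,
      PName.ForcesReal matetReal.{u} p ∧ PName.ForcesNew matetReal.{u} p) ∧
    ∀ (p : MatetCond) (x : PName.{u} MatetCond),
      PName.ForcesReal x p → PName.ForcesNew x p →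
      ∃ q ≤ p, q.stem = p.stem ∧
        ∃ f : (ℕ → Bool) → ℕ → Bool,
          ContinuousOn f q.branches ∧ Set.InjOn f q.branches ∧
          PName.ForcesEq (PName.image q.branches f matetReal) x q ∧
          ∃ g : (ℕ → Bool) → ℕ → Bool,
            ContinuousOn g (f '' q.branches) ∧ Set.LeftInvOn g f q.branches ∧
            PName.ForcesEq (PName.image (f '' q.branches) g x) matetReal q := by
  refine ⟨fun p => ⟨MatetCond.forcesReal_matetReal p, MatetCond.forcesNew_matetReal p⟩,
    fun p x hxr hxn => ?_⟩
  obtain ⟨q, b, F, hq, hb, hlt, hFc, hFi, hF⟩ := MatetCond.exists_coding hxr hxn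
  have hmem : ∀ i, b i ∈ q.blocks := fun i => hb ▸ ⟨i, rfl⟩
  have hs : ∀ i, BlockLT q.stem (b i) := fun i => q.stem_lt _ (hmem i)
  have hYc := MatetCond.continuous_unionOf hlt hs
  have hYi := MatetCond.injective_unionOf (fun i => q.nonempty _ (hmem i)) hlt hs
  have hsub := MatetCond.branches_subset_range_unionOf hb
  have hreads := MatetCond.reads_of_coding hb hlt hF
  set Y := MatetCond.unionOf q.stem b
  have hfc : ContinuousOn (fun y => F (invFun Y y)) q.branches :=
    hFc.comp_continuousOn ((MatetCond.continuousOn_invFun_range hYc hYi).mono hsub)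
  have hgc : ContinuousOn (fun z => Y (invFun F z)) ((fun y => F (invFun Y y)) '' q.branches) :=
    hYc.comp_continuousOn ((MatetCond.continuousOn_invFun_range hFc hFi).mono (by
      rintro _ ⟨y, -, rfl⟩
      exact ⟨_, rfl⟩))
  have hgf : Set.LeftInvOn (fun z => Y (invFun F z)) (fun y => F (invFun Y y)) q.branches := by
    intro y hy
    dsimp only
    rw [leftInverse_invFun hFi, invFun_eq (hsub hy)]
  refine ⟨q, hq.1, hq.2, _, hfc, hgf.injOn, ?_, _, hgc, hgf, ?_⟩
  · have h := MatetCond.forcesEq_image (MatetCond.reads_matetReal.{u} q) hreads (hxr.mono hq.1)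
      (by simpa only [Set.image_id] using hfc) fun _ _ => rfl
    rwa [Set.image_id] at h
  · exact MatetCond.forcesEq_image hreads (MatetCond.reads_matetReal q)
      (MatetCond.forcesReal_matetReal q) hgc hgf
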